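/- Let $(M,g)$ be a connected smooth Riemannian manifold (without boundary) with Levi-Civita connection $\nabla$, and let $\varphi \in C^\infty(S^2M)$ be a smooth symmetric bilinear form on $M$, viewed as a one-form with values in the cotangent bundle $T^*M$. Let $$ d^\nabla\varphi\,(X,Y,Z) = (\nabla_X\varphi)(Y,Z) - (\nabla_Y\varphi)(X,Z) $$ be its exterior differential, and let $\delta^\nabla\varphi$ be the one-form obtained by applying to $\varphi$ the formal adjoint $\delta^\nabla$ of the exterior differential $d^\nabla\theta\,(X,Y) = (\nabla_X\theta)(Y)$ on one-forms $\theta$ (regarded as $T^*M$-valued zero-forms); that is, $$ \int_M g(\varphi, d^\nabla\theta)\, dv_g = \int_M g(\delta^\nabla\varphi,\theta)\, dv_g $$ for every smooth compactly supported one-form $\theta$. The form $\varphi$ is called harmonic if $d^\nabla\varphi = 0$ and $\delta^\nabla\varphi = 0$, and it is called a Codazzi tensor if its covariant derivative $\nabla\varphi$ is a symmetric tensor. Then $\varphi$ is harmonic if and only if it is a Codazzi tensor whose trace $\operatorname{trace}_g\varphi$ is constant on $M$. -/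

import Mathlib

open Bundle Manifold ContDiff MeasureTheory

set_option linter.unusedSectionVars false

noncomputable section

namespace RiemannianForms

section LeviCivita

variable {E : Type*} [NormedAddCommGroup E] [NormedSpace ℝ E] [FiniteDimensional ℝ E]
  {H : Type*} [TopologicalSpace H] (I : ModelWithCorners ℝ E H)
  {M : Type*} [TopologicalSpace M] [ChartedSpace H M]
  [RiemannianBundle (fun x : M ↦ TangentSpace I x)]

/-- The right-hand side of the Koszul formula for `2 g(∇_X Y, Z)` at the point `x`. -/
def koszul (X Y Z : Π x : M, TangentSpace I x) (x : M) : ℝ :=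
  mvfderiv I (fun y ↦ inner ℝ (Y y) (Z y)) x (X x)
    + mvfderiv I (fun y ↦ inner ℝ (X y) (Z y)) x (Y x)
    - mvfderiv I (fun y ↦ inner ℝ (X y) (Y y)) x (Z x)
    + inner ℝ (VectorField.mlieBracket I X Y x) (Z x)
    - inner ℝ (VectorField.mlieBracket I X Z x) (Y x)
    - inner ℝ (VectorField.mlieBracket I Y Z x) (X x)

variable {I} [IsManifold I ∞ M]
  [IsContMDiffRiemannianBundle I ∞ E (fun x : M ↦ TangentSpace I x)]

section
variable {X X' Y Y' Z Z' : Π x : M, TangentSpace I x} {f : M → ℝ} {x : M}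

lemma mdifferentiableAt_inner (hX : MDiffAt (T% X) x) (hY : MDiffAt (T% Y) x) :
    MDiffAt (fun y ↦ (inner ℝ (X y) (Y y) : ℝ)) x :=
  MDifferentiableAt.inner_bundle (E := fun y : M ↦ TangentSpace I y) (b := fun y ↦ y) hX hY

lemma koszul_add_left (hX : MDiffAt (T% X) x) (hX' : MDiffAt (T% X') x)
    (hY : MDiffAt (T% Y) x) (hZ : MDiffAt (T% Z) x) :
    koszul I (X + X') Y Z x = koszul I X Y Z x + koszul I X' Y Z x := by
  simp only [koszul, Pi.add_apply, inner_add_left, inner_add_right,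
    mvfderiv_fun_add (mdifferentiableAt_inner hX hZ) (mdifferentiableAt_inner hX' hZ),
    mvfderiv_fun_add (mdifferentiableAt_inner hX hY) (mdifferentiableAt_inner hX' hY),
    VectorField.mlieBracket_add_left hX hX', map_add, add_apply]
  ring

lemma koszul_smul_left (hf : MDiffAt f x) (hX : MDiffAt (T% X) x)
    (hY : MDiffAt (T% Y) x) (hZ : MDiffAt (T% Z) x) :
    koszul I (f • X) Y Z x = f x * koszul I X Y Z x := by
  simp only [koszul, Pi.smul_apply', inner_add_left, inner_smul_left, inner_smul_right,
    mvfderiv_fun_mul hf (mdifferentiableAt_inner hX hZ),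
    mvfderiv_fun_mul hf (mdifferentiableAt_inner hX hY),
    VectorField.mlieBracket_smul_left hf hX, map_smul, add_apply,
    smul_apply, smul_eq_mul, conj_trivial, neg_smul, inner_neg_left]
  rw [real_inner_comm (Y x) (X x)]
  ring

lemma koszul_add_right (hX : MDiffAt (T% X) x) (hY : MDiffAt (T% Y) x)
    (hZ : MDiffAt (T% Z) x) (hZ' : MDiffAt (T% Z') x) :
    koszul I X Y (Z + Z') x = koszul I X Y Z x + koszul I X Y Z' x := by
  simp only [koszul, Pi.add_apply, inner_add_left, inner_add_right,
    mvfderiv_fun_add (mdifferentiableAt_inner hX hZ) (mdifferentiableAt_inner hX hZ'),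
    mvfderiv_fun_add (mdifferentiableAt_inner hY hZ) (mdifferentiableAt_inner hY hZ'),
    VectorField.mlieBracket_add_right hZ hZ', map_add, add_apply]
  ring

lemma koszul_smul_right (hf : MDiffAt f x) (hX : MDiffAt (T% X) x)
    (hY : MDiffAt (T% Y) x) (hZ : MDiffAt (T% Z) x) :
    koszul I X Y (f • Z) x = f x * koszul I X Y Z x := by
  simp only [koszul, Pi.smul_apply', inner_add_left, inner_smul_left, inner_smul_right,
    mvfderiv_fun_mul hf (mdifferentiableAt_inner hX hZ),
    mvfderiv_fun_mul hf (mdifferentiableAt_inner hY hZ),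
    VectorField.mlieBracket_smul_right hf hZ, map_smul, add_apply,
    smul_apply, smul_eq_mul, conj_trivial]
  rw [real_inner_comm (X x) (Z x), real_inner_comm (Y x) (Z x)]
  ring

lemma koszul_add_middle (hX : MDiffAt (T% X) x) (hY : MDiffAt (T% Y) x)
    (hY' : MDiffAt (T% Y') x) (hZ : MDiffAt (T% Z) x) :
    koszul I X (Y + Y') Z x = koszul I X Y Z x + koszul I X Y' Z x := by
  simp only [koszul, Pi.add_apply, inner_add_left, inner_add_right,
    mvfderiv_fun_add (mdifferentiableAt_inner hY hZ) (mdifferentiableAt_inner hY' hZ),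
    mvfderiv_fun_add (mdifferentiableAt_inner hX hY) (mdifferentiableAt_inner hX hY'),
    VectorField.mlieBracket_add_right hY hY', VectorField.mlieBracket_add_left hY hY',
    map_add, add_apply]
  ring

lemma koszul_smul_middle (hf : MDiffAt f x) (hX : MDiffAt (T% X) x)
    (hY : MDiffAt (T% Y) x) (hZ : MDiffAt (T% Z) x) :
    koszul I X (f • Y) Z x =
      f x * koszul I X Y Z x + 2 * (mvfderiv I f x (X x) * inner ℝ (Y x) (Z x)) := by
  simp only [koszul, Pi.smul_apply', inner_add_left, inner_smul_left, inner_smul_right,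
    mvfderiv_fun_mul hf (mdifferentiableAt_inner hY hZ),
    mvfderiv_fun_mul hf (mdifferentiableAt_inner hX hY),
    VectorField.mlieBracket_smul_left hf hY, VectorField.mlieBracket_smul_right hf hY,
    map_smul, add_apply,
    smul_apply, smul_eq_mul, conj_trivial, neg_smul, inner_neg_left]
  rw [real_inner_comm (Y x) (X x)]
  ring

end

/-- For `Y` differentiable at `x`, the bilinear form `(u, w) ↦ 2 g(∇_u Y, w)` on `T_x M`. -/
def koszulForm (Y : Π x : M, TangentSpace I x) (x : M) (hY : MDiffAt (T% Y) x) :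
    TangentSpace I x →L[ℝ] TangentSpace I x →L[ℝ] ℝ :=
  TensorialAt.mkHom₂ (fun X Z ↦ koszul I X Y Z x) x
    (fun _ hZ ↦ ⟨fun hf hX ↦ koszul_smul_left hf hX hY hZ,
      fun hX hX' ↦ koszul_add_left hX hX' hY hZ⟩)
    (fun _ hX ↦ ⟨fun hf hZ ↦ koszul_smul_right hf hX hY hZ,
      fun hZ hZ' ↦ koszul_add_right hX hY hZ hZ'⟩)

lemma koszulForm_apply {X Y Z : Π x : M, TangentSpace I x} {x : M} (hX : MDiffAt (T% X) x)
    (hY : MDiffAt (T% Y) x) (hZ : MDiffAt (T% Z) x) :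
    koszulForm Y x hY (X x) (Z x) = koszul I X Y Z x :=
  TensorialAt.mkHom₂_apply _ _ hX hZ

variable (I) in
instance instFiniteDimensionalTangentSpace (x : M) : FiniteDimensional ℝ (TangentSpace I x) :=
  inferInstanceAs (FiniteDimensional ℝ E)

open scoped Classical in
/-- The Levi-Civita derivative as a function: `leviCivitaFun Y x u` is the vector `∇_u Y` of
`T_x M` whose inner product with any `w` is given by the Koszul formula. It is set to be `0`
where `Y` is not differentiable. -/
def leviCivitaFun (Y : Π x : M, TangentSpace I x) (x : M) :
    TangentSpace I x →L[ℝ] TangentSpace I x :=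
  if hY : MDiffAt (T% Y) x then
    (1 / 2 : ℝ) • ∑ i, ((koszulForm Y x hY).flip
      (stdOrthonormalBasis ℝ (TangentSpace I x) i)).smulRight
        (stdOrthonormalBasis ℝ (TangentSpace I x) i)
  else 0

lemma inner_leviCivitaFun {Y : Π x : M, TangentSpace I x} {x : M} (hY : MDiffAt (T% Y) x)
    (u w : TangentSpace I x) :
    inner ℝ (leviCivitaFun Y x u) w = 1 / 2 * koszulForm Y x hY u w := by
  rw [leviCivitaFun, dif_pos hY]
  conv_rhs => rw [← (stdOrthonormalBasis ℝ (TangentSpace I x)).sum_repr' w]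
  simp only [smul_apply, sum_apply, ContinuousLinearMap.smulRight_apply,
    ContinuousLinearMap.flip_apply, inner_smul_left, sum_inner, map_sum, map_smul, smul_eq_mul,
    conj_trivial]
  congr 1
  exact Finset.sum_congr rfl fun i _ ↦ mul_comm _ _

lemma two_inner_leviCivitaFun {X Y Z : Π x : M, TangentSpace I x} {x : M} (hX : MDiffAt (T% X) x)
    (hY : MDiffAt (T% Y) x) (hZ : MDiffAt (T% Z) x) :
    2 * inner ℝ (leviCivitaFun Y x (X x)) (Z x) = koszul I X Y Z x := by
  rw [inner_leviCivitaFun hY, koszulForm_apply hX hY hZ]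
  ring

lemma leviCivitaFun_ext {x : M} {u v : TangentSpace I x}
    (h : ∀ Z : Π x : M, TangentSpace I x, MDiffAt (T% Z) x →
      (2 * inner ℝ u (Z x) : ℝ) = 2 * inner ℝ v (Z x)) : u = v := by
  refine ext_inner_right ℝ fun w ↦ ?_
  have := h (FiberBundle.extend E w) (FiberBundle.mdifferentiableAt_extend ..)
  simpa using this

variable (I M) in
/-- The Levi-Civita connection of a Riemannian manifold. -/
def leviCivita : CovariantDerivative I E (fun x : M ↦ TangentSpace I x) where
  toFun := leviCivitaFun
  isCovariantDerivativeOnUniv :=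
    { add := by
        intro Y Y' x hY hY' _
        ext u
        refine leviCivitaFun_ext fun Z hZ ↦ ?_
        have hu := FiberBundle.mdifferentiableAt_extend I E (x := x) u
        have e := FiberBundle.extend_apply_self E u
        rw [← e, add_apply, inner_add_left, mul_add,
          two_inner_leviCivitaFun hu (mdifferentiableAt_add_section hY hY') hZ,
          two_inner_leviCivitaFun hu hY hZ, two_inner_leviCivitaFun hu hY' hZ,
          koszul_add_middle hu hY hY' hZ]
      leibniz := by
        intro Y f x hY hf _
        ext u
        refine leviCivitaFun_ext fun Z hZ ↦ ?_
        have hu := FiberBundle.mdifferentiableAt_extend I E (x := x) u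
        have e := FiberBundle.extend_apply_self E u
        rw [← e, add_apply, inner_add_left, mul_add, smul_apply, inner_smul_left,
          ContinuousLinearMap.smulRight_apply, inner_smul_left,
          two_inner_leviCivitaFun hu (hf.smul_section hY) hZ, mul_left_comm,
          two_inner_leviCivitaFun hu hY hZ, koszul_smul_middle hf hu hY hZ]
        simp }

/-- The Levi-Civita connection is torsion-free. -/
lemma leviCivita_torsion : (leviCivita I M).torsion = 0 := by
  rw [CovariantDerivative.torsion_eq_zero_iff]
  intro X Y x hX hY
  refine leviCivitaFun_ext fun Z hZ ↦ ?_
  change 2 * inner ℝ (leviCivitaFun Y x (X x) - leviCivitaFun X x (Y x)) (Z x) = _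
  rw [inner_sub_left, mul_sub, two_inner_leviCivitaFun hX hY hZ,
    two_inner_leviCivitaFun hY hX hZ, koszul, koszul, VectorField.mlieBracket_swap_apply (V := Y) (W := X),
    inner_neg_left]
  have h1 : (fun y ↦ (inner ℝ (Y y) (X y) : ℝ)) = fun y ↦ inner ℝ (X y) (Y y) := by
    ext y; exact real_inner_comm _ _
  rw [h1]
  ring

/-- The Levi-Civita connection is compatible with the metric. -/
lemma leviCivita_metric {X Y Z : Π x : M, TangentSpace I x} {x : M} (hX : MDiffAt (T% X) x)
    (hY : MDiffAt (T% Y) x) (hZ : MDiffAt (T% Z) x) :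
    mvfderiv I (fun y ↦ (inner ℝ (Y y) (Z y) : ℝ)) x (X x) =
      inner ℝ (leviCivita I M Y x (X x)) (Z x) + inner ℝ (Y x) (leviCivita I M Z x (X x)) := by
  have h1 := two_inner_leviCivitaFun hX hY hZ
  have h2 := two_inner_leviCivitaFun hX hZ hY
  change _ = inner ℝ (leviCivitaFun Y x (X x)) (Z x) + inner ℝ (Y x) (leviCivitaFun Z x (X x))
  rw [koszul] at h1 h2
  rw [VectorField.mlieBracket_swap_apply (V := Z) (W := Y), inner_neg_left] at h2
  rw [real_inner_comm (leviCivitaFun Z x (X x)) (Y x)]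
  have h3 : (fun y ↦ (inner ℝ (Z y) (Y y) : ℝ)) = fun y ↦ inner ℝ (Y y) (Z y) := by
    ext y; exact real_inner_comm _ _
  rw [h3] at h2
  linarith

end LeviCivita

section Forms

variable {E : Type*} [NormedAddCommGroup E] [NormedSpace ℝ E] [FiniteDimensional ℝ E]
  {H : Type*} [TopologicalSpace H] (I : ModelWithCorners ℝ E H)
  (M : Type*) [TopologicalSpace M] [ChartedSpace H M]

/-- (Not necessarily smooth) one-forms on `M`, that is, sections of `T^*M`. -/
abbrev OneForm := Π x : M, TangentSpace I x →L[ℝ] ℝ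

/-- (Not necessarily smooth or symmetric) bilinear forms on `M`, that is, sections of
`T^*M ⊗ T^*M`; equivalently, one-forms on `M` with values in the cotangent bundle. -/
abbrev BilinForm := Π x : M, TangentSpace I x →L[ℝ] TangentSpace I x →L[ℝ] ℝ

variable {I M} [IsManifold I ∞ M]

/-- `θ` is a smooth section of the cotangent bundle. -/
def OneForm.IsSmooth (θ : OneForm I M) : Prop :=
  ContMDiff I (I.prod 𝓘(ℝ, E →L[ℝ] ℝ)) ∞
    (fun x ↦ TotalSpace.mk' (E →L[ℝ] ℝ) (E := fun x : M ↦ TangentSpace I x →L[ℝ] ℝ) x (θ x))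

/-- `φ` is a smooth section of the bundle of bilinear forms on the tangent spaces. -/
def BilinForm.IsSmooth (φ : BilinForm I M) : Prop :=
  ContMDiff I (I.prod 𝓘(ℝ, E →L[ℝ] E →L[ℝ] ℝ)) ∞
    (fun x ↦ TotalSpace.mk' (E →L[ℝ] E →L[ℝ] ℝ)
      (E := fun x : M ↦ TangentSpace I x →L[ℝ] TangentSpace I x →L[ℝ] ℝ) x (φ x))

/-- `φ` is a smooth symmetric bilinear form: a smooth section of `S^2 M`. -/
structure BilinForm.IsSmoothSymm (φ : BilinForm I M) : Prop where
  smooth : φ.IsSmooth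
  symm : ∀ (x : M) (u v : TangentSpace I x), φ x u v = φ x v u

variable [RiemannianBundle (fun x : M ↦ TangentSpace I x)]
  [IsContMDiffRiemannianBundle I ∞ E (fun x : M ↦ TangentSpace I x)]

/-- The covariant derivative of a one-form: `θ.covDeriv x u v = (∇_u θ)(v)`. With the vector `v`
extended to a vector field `V`, this is `u(θ(V)) - θ(∇_u V)`, which does not depend on the
extension (see `OneForm.covDeriv_apply`). -/
def OneForm.covDeriv (θ : OneForm I M) (x : M) (u v : TangentSpace I x) : ℝ :=
  mvfderiv I (fun y ↦ θ y (FiberBundle.extend E v y)) x u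
    - θ x (leviCivita I M (FiberBundle.extend E v) x u)

/-- The covariant derivative of a bilinear form: `φ.covDeriv x u v w = (∇_u φ)(v, w)`. With the
vectors `v`, `w` extended to vector fields `V`, `W`, this is
`u(φ(V, W)) - φ(∇_u V, w) - φ(v, ∇_u W)`, which does not depend on the extensions
(see `BilinForm.covDeriv_apply`). -/
def BilinForm.covDeriv (φ : BilinForm I M) (x : M) (u v w : TangentSpace I x) : ℝ :=
  mvfderiv I (fun y ↦ φ y (FiberBundle.extend E v y) (FiberBundle.extend E w y)) x u
    - φ x (leviCivita I M (FiberBundle.extend E v) x u) w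
    - φ x v (leviCivita I M (FiberBundle.extend E w) x u)

section
variable {θ : OneForm I M} {φ : BilinForm I M} {x : M} {Y Z : Π x : M, TangentSpace I x}

lemma OneForm.IsSmooth.mdifferentiableAt_apply (hθ : θ.IsSmooth) (hY : MDiffAt (T% Y) x) :
    MDiffAt (fun y ↦ θ y (Y y)) x := by
  have h : MDifferentiableAt I (I.prod 𝓘(ℝ, ℝ))
      (fun y ↦ TotalSpace.mk' ℝ (E := Bundle.Trivial M ℝ) y (θ y (Y y))) x :=
    MDifferentiableAt.clm_bundle_apply (F₁ := E) (F₂ := ℝ)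
      (E₁ := fun x : M ↦ TangentSpace I x) (E₂ := Bundle.Trivial M ℝ) (b := fun y ↦ y)
      ((ContMDiff.mdifferentiable hθ (by simp)) x) hY
  simp only [mdifferentiableAt_totalSpace] at h
  exact h.2

lemma BilinForm.IsSmooth.mdifferentiableAt_apply (hφ : φ.IsSmooth) (hY : MDiffAt (T% Y) x)
    (hZ : MDiffAt (T% Z) x) : MDiffAt (fun y ↦ φ y (Y y) (Z y)) x := by
  have h : MDifferentiableAt I (I.prod 𝓘(ℝ, ℝ))
      (fun y ↦ TotalSpace.mk' ℝ (E := Bundle.Trivial M ℝ) y (φ y (Y y) (Z y))) x :=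
    MDifferentiableAt.clm_bundle_apply₂ (F₁ := E) (F₂ := E) (F₃ := ℝ)
      (E₁ := fun x : M ↦ TangentSpace I x) (E₂ := fun x : M ↦ TangentSpace I x)
      (E₃ := Bundle.Trivial M ℝ) (b := fun y ↦ y)
      ((ContMDiff.mdifferentiable hφ (by simp)) x) hY hZ
  simp only [mdifferentiableAt_totalSpace] at h
  exact h.2

lemma OneForm.covDeriv_apply (hθ : θ.IsSmooth) (u : TangentSpace I x) (hY : MDiffAt (T% Y) x) :
    θ.covDeriv x u (Y x) =
      mvfderiv I (fun y ↦ θ y (Y y)) x u - θ x (leviCivita I M Y x u) := by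
  have cov := (leviCivita I M).isCovariantDerivativeOnUniv
  have key : TensorialAt I E (fun V : Π x : M, TangentSpace I x ↦
      mvfderiv I (fun y ↦ θ y (V y)) x u - θ x (leviCivita I M V x u)) x :=
    { smul := by
        intro f V hf hV
        simp only [Pi.smul_apply', map_smul, smul_eq_mul,
          mvfderiv_fun_mul hf (hθ.mdifferentiableAt_apply hV), cov.leibniz hV hf, add_apply,
          smul_apply, ContinuousLinearMap.smulRight_apply, map_add]
        ring
      add := by
        intro V V' hV hV'
        simp only [Pi.add_apply, map_add, cov.add hV hV', add_apply,
          mvfderiv_fun_add (hθ.mdifferentiableAt_apply hV) (hθ.mdifferentiableAt_apply hV')]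
        ring }
  exact key.pointwise (FiberBundle.mdifferentiableAt_extend ..) hY (by simp)

lemma BilinForm.covDeriv_apply (hφ : φ.IsSmooth) (u : TangentSpace I x)
    (hY : MDiffAt (T% Y) x) (hZ : MDiffAt (T% Z) x) :
    φ.covDeriv x u (Y x) (Z x) =
      mvfderiv I (fun y ↦ φ y (Y y) (Z y)) x u
        - φ x (leviCivita I M Y x u) (Z x) - φ x (Y x) (leviCivita I M Z x u) := by
  have cov := (leviCivita I M).isCovariantDerivativeOnUniv
  have key₁ : ∀ W : Π x : M, TangentSpace I x, MDiffAt (T% W) x →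
      TensorialAt I E (fun V : Π x : M, TangentSpace I x ↦
        mvfderiv I (fun y ↦ φ y (V y) (W y)) x u
          - φ x (leviCivita I M V x u) (W x) - φ x (V x) (leviCivita I M W x u)) x := by
    intro W hW
    refine ⟨fun {f V} hf hV ↦ ?_, fun {V V'} hV hV' ↦ ?_⟩
    · simp only [Pi.smul_apply', map_smul, smul_eq_mul,
        mvfderiv_fun_mul hf (hφ.mdifferentiableAt_apply hV hW), cov.leibniz hV hf, add_apply,
        smul_apply, ContinuousLinearMap.smulRight_apply, map_add]
      ring
    · simp only [Pi.add_apply, map_add, cov.add hV hV', add_apply,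
        mvfderiv_fun_add (hφ.mdifferentiableAt_apply hV hW) (hφ.mdifferentiableAt_apply hV' hW)]
      ring
  have key₂ : ∀ V : Π x : M, TangentSpace I x, MDiffAt (T% V) x →
      TensorialAt I E (fun W : Π x : M, TangentSpace I x ↦
        mvfderiv I (fun y ↦ φ y (V y) (W y)) x u
          - φ x (leviCivita I M V x u) (W x) - φ x (V x) (leviCivita I M W x u)) x := by
    intro V hV
    refine ⟨fun {f W} hf hW ↦ ?_, fun {W W'} hW hW' ↦ ?_⟩
    · simp only [Pi.smul_apply', map_smul, smul_eq_mul,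
        mvfderiv_fun_mul hf (hφ.mdifferentiableAt_apply hV hW), cov.leibniz hW hf, add_apply,
        smul_apply, ContinuousLinearMap.smulRight_apply, map_add]
      ring
    · simp only [Pi.add_apply, map_add, cov.add hW hW', add_apply,
        mvfderiv_fun_add (hφ.mdifferentiableAt_apply hV hW) (hφ.mdifferentiableAt_apply hV hW')]
      ring
  have := TensorialAt.pointwise₂ key₁ key₂ (FiberBundle.mdifferentiableAt_extend I E (Y x)) hY
    (FiberBundle.mdifferentiableAt_extend I E (Z x)) hZ (by simp) (by simp)
  simpa [BilinForm.covDeriv] using this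

end

/-- The exterior differential `d^∇` on `T^*M`-valued zero-forms, that is, on one-forms `θ`:
`(d^∇ θ)(X, Y) = (∇_X θ)(Y)`. -/
def OneForm.extDeriv (θ : OneForm I M) (x : M) (u v : TangentSpace I x) : ℝ :=
  θ.covDeriv x u v

/-- The exterior differential `d^∇` on `T^*M`-valued one-forms:
`(d^∇ φ)(X, Y, Z) = (∇_X φ)(Y, Z) - (∇_Y φ)(X, Z)`. -/
def BilinForm.extDeriv (φ : BilinForm I M) (x : M) (u v w : TangentSpace I x) : ℝ :=
  φ.covDeriv x u v w - φ.covDeriv x v u w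

/-- The covariant derivative `∇φ` is a symmetric tensor of type `(0, 3)` (the two transpositions
generate all permutations of the three arguments). -/
def BilinForm.IsCodazzi (φ : BilinForm I M) : Prop :=
  ∀ (x : M) (u v w : TangentSpace I x),
    φ.covDeriv x u v w = φ.covDeriv x v u w ∧ φ.covDeriv x u v w = φ.covDeriv x u w v

/-- The trace of a bilinear form with respect to the metric. -/
def BilinForm.trace (φ : BilinForm I M) (x : M) : ℝ :=
  ∑ i, φ x (stdOrthonormalBasis ℝ (TangentSpace I x) i)
    (stdOrthonormalBasis ℝ (TangentSpace I x) i)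

variable (I) in
/-- The inner product of covectors at `x` induced by the metric. -/
def covectorInner (x : M) (α β : TangentSpace I x → ℝ) : ℝ :=
  ∑ i, α (stdOrthonormalBasis ℝ (TangentSpace I x) i)
    * β (stdOrthonormalBasis ℝ (TangentSpace I x) i)

variable (I) in
/-- The inner product of bilinear forms on `T_x M` induced by the metric. -/
def bilinInner (x : M) (a b : TangentSpace I x → TangentSpace I x → ℝ) : ℝ :=
  ∑ i, ∑ j, a (stdOrthonormalBasis ℝ (TangentSpace I x) i)
      (stdOrthonormalBasis ℝ (TangentSpace I x) j)
    * b (stdOrthonormalBasis ℝ (TangentSpace I x) i)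
      (stdOrthonormalBasis ℝ (TangentSpace I x) j)

end Forms

section Volume

variable {n : ℕ} {M : Type*} [TopologicalSpace M] [ChartedSpace (EuclideanSpace ℝ (Fin n)) M]
  [RiemannianBundle (fun x : M ↦ TangentSpace (𝓡 n) x)]

/-- The matrix `g_ij = g(∂_i, ∂_j)` of the metric in the chart at `c`, as a function of the
coordinates `p`. -/
def gramMatrix (c : M) (p : EuclideanSpace ℝ (Fin n)) : Matrix (Fin n) (Fin n) ℝ :=
  Matrix.of fun i j ↦
    inner ℝ
      (mfderiv (𝓡 n) (𝓡 n) (extChartAt (𝓡 n) c).symm p (EuclideanSpace.single i (1 : ℝ)))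
      (mfderiv (𝓡 n) (𝓡 n) (extChartAt (𝓡 n) c).symm p (EuclideanSpace.single j (1 : ℝ)))

variable [MeasurableSpace M]

/-- The measure on `M` that is `√(det g_ij) dp` in the chart at `c` and vanishes outside the
domain of this chart. -/
def chartVolume (c : M) : Measure M :=
  Measure.map (extChartAt (𝓡 n) c).symm
    ((volume.restrict (extChartAt (𝓡 n) c).target).withDensity
      fun p ↦ ENNReal.ofReal (√(gramMatrix c p).det))

variable (n M) in
/-- The Riemannian volume measure. The measures `chartVolume c` agree on the overlaps of chart
domains, so their supremum is the measure that is `√(det g_ij) dp` in every chart. -/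
def riemannianVolume : Measure M :=
  ⨆ c : M, chartVolume (n := n) c

variable [IsManifold (𝓡 n) ∞ M]
  [IsContMDiffRiemannianBundle (𝓡 n) ∞ (EuclideanSpace ℝ (Fin n))
    (fun x : M ↦ TangentSpace (𝓡 n) x)]

/-- The one-form `η` is the value `δ^∇ φ` at `φ` of the formal adjoint `δ^∇` of
`d^∇ : C^∞(T^*M) → C^∞(T^*M ⊗ T^*M)`: one has `⟨φ, d^∇ θ⟩ = ⟨η, θ⟩` for the global scalar products
with every smooth compactly supported one-form `θ`. -/
def BilinForm.IsCodifferential (φ : BilinForm (𝓡 n) M) (η : OneForm (𝓡 n) M) : Prop :=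
  η.IsSmooth ∧ ∀ θ : OneForm (𝓡 n) M, θ.IsSmooth → IsCompact (closure {x | θ x ≠ 0}) →
    ∫ x, bilinInner (𝓡 n) x (fun u v ↦ φ x u v) (θ.extDeriv x) ∂(riemannianVolume n M) =
      ∫ x, covectorInner (𝓡 n) x (η x) (θ x) ∂(riemannianVolume n M)

/-- `φ` is harmonic: `d^∇ φ = 0` and `δ^∇ φ = 0`. -/
def BilinForm.IsHarmonic (φ : BilinForm (𝓡 n) M) : Prop :=
  (∀ (x : M) (u v w : TangentSpace (𝓡 n) x), φ.extDeriv x u v w = 0) ∧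
    φ.IsCodifferential (fun _ ↦ 0)

end Volume

end RiemannianForms

end

noncomputable section

namespace RiemannianForms

open Filter Topology Set

section CoordFrame

variable {E : Type*} [NormedAddCommGroup E] [NormedSpace ℝ E] [FiniteDimensional ℝ E]
  {H : Type*} [TopologicalSpace H] (I : ModelWithCorners ℝ E H)
  {M : Type*} [TopologicalSpace M] [ChartedSpace H M] [IsManifold I ∞ M]
  {ι : Type*} (b : Module.Basis ι ℝ E)

/-- The vector fields `∂_i` of the chart at `c` with respect to a basis of the model space; they
vanish outside the domain of the chart. -/
def coordFrame (c : M) (i : ι) : Π x : M, TangentSpace I x :=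
  (trivializationAt E (TangentSpace I) c).localFrame b i

/-- The components of tangent vectors with respect to `coordFrame`. -/
def coordCoeff (c : M) (i : ι) (x : M) : TangentSpace I x →ₗ[ℝ] ℝ :=
  (trivializationAt E (TangentSpace I) c).localFrameCoeff I b i x

/-- The basis of coordinate vectors of the tangent space at a point of the chart at `c`. -/
def coordBasis {c x : M} (hx : x ∈ (chartAt H c).source) :
    Module.Basis ι ℝ (TangentSpace I x) :=
  (trivializationAt E (TangentSpace I) c).basisAt b hx

/-- A vector of the model space as a constant vector field. -/
def constVectorField (e : E) (y : E) : TangentSpace 𝓘(ℝ, E) y := e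

variable {I b} {c x : M} {X : Π x : M, TangentSpace I x}

lemma coordBasis_apply (hx : x ∈ (chartAt H c).source) (i : ι) :
    coordBasis I b hx i = coordFrame I b c i x := by
  rw [coordFrame, Trivialization.localFrame_apply_of_mem_baseSet _ _ hx, coordBasis]

lemma coordBasis_repr (hx : x ∈ (chartAt H c).source) (v : TangentSpace I x) (i : ι) :
    (coordBasis I b hx).repr v i = coordCoeff I b c i x v := by
  have := Trivialization.localFrameCoeff_apply_of_mem_baseSet (I := I)
    (e := trivializationAt E (TangentSpace I) c) b hx (FiberBundle.extend E v) i
  rw [FiberBundle.extend_apply_self] at this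
  exact this.symm

lemma contMDiffAt_coordFrame (hx : x ∈ (chartAt H c).source) (i : ι) :
    CMDiffAt ∞ (T% (coordFrame I b c i)) x :=
  contMDiffAt_localFrame_of_mem ∞ (trivializationAt E (TangentSpace I) c) _ i hx

lemma mdifferentiableAt_coordFrame (hx : x ∈ (chartAt H c).source) (i : ι) :
    MDiffAt (T% (coordFrame I b c i)) x :=
  (contMDiffAt_coordFrame hx i).mdifferentiableAt (by simp)

lemma contMDiffAt_iff_coordCoeff (hx : x ∈ (chartAt H c).source) :
    CMDiffAt ∞ (T% X) x ↔ ∀ i, CMDiffAt ∞ (fun y ↦ coordCoeff I b c i y (X y)) x :=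
  contMDiffAt_iff_localFrameCoeff (e := trivializationAt E (TangentSpace I) c) b hx

lemma mdifferentiableAt_coordCoeff (hx : x ∈ (chartAt H c).source) (hX : MDiffAt (T% X) x)
    (i : ι) : MDiffAt (fun y ↦ coordCoeff I b c i y (X y)) x :=
  mdifferentiableAt_localFrameCoeff (e := trivializationAt E (TangentSpace I) c) b hx hX i

lemma coordFrame_eq_mfderiv_symm [I.Boundaryless] (hx : x ∈ (chartAt H c).source) (i : ι) :
    coordFrame I b c i x =
      mfderiv 𝓘(ℝ, E) I (extChartAt I c).symm (extChartAt I c x) (b i) := by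
  have h := TangentBundle.symmL_trivializationAt (I := I) hx
  rw [ModelWithCorners.range_eq_univ, mfderivWithin_univ] at h
  rw [← h, coordFrame, Trivialization.localFrame_apply_of_mem_baseSet _ _ hx]
  simp only [Trivialization.basisAt, Module.Basis.map_apply]
  exact (Trivialization.symmL_apply _ hx _).symm

lemma mfderiv_extChartAt_coordFrame [I.Boundaryless] (hx : x ∈ (chartAt H c).source) (i : ι) :
    mfderiv I 𝓘(ℝ, E) (extChartAt I c) x (coordFrame I b c i x) = b i := by
  have hx' : x ∈ (extChartAt I c).source := by rwa [extChartAt_source]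
  have h2 := mfderiv_extChartAt_comp_mfderivWithin_extChartAt_symm' (I := I) hx'
  rw [ModelWithCorners.range_eq_univ, mfderivWithin_univ] at h2
  rw [coordFrame_eq_mfderiv_symm hx]
  exact DFunLike.congr_fun h2 (b i)

lemma coordFrame_eq_mpullback [I.Boundaryless] (hx : x ∈ (chartAt H c).source) (i : ι) :
    coordFrame I b c i x =
      VectorField.mpullback I 𝓘(ℝ, E) (extChartAt I c) (constVectorField (b i))
        x := by
  have hx' : x ∈ (extChartAt I c).source := by rwa [extChartAt_source]
  rw [VectorField.mpullback_apply]
  have h := isInvertible_mfderiv_extChartAt (I := I) hx'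
  rw [← mfderiv_extChartAt_coordFrame (I := I) hx]
  exact (h.inverse_apply_eq.2 rfl).symm

lemma mlieBracket_coordFrame [I.Boundaryless] (hx : x ∈ (chartAt H c).source) (i j : ι) :
    VectorField.mlieBracket I (coordFrame I b c i) (coordFrame I b c j) x = 0 := by
  have h (k : ι) : coordFrame I b c k =ᶠ[𝓝 x] VectorField.mpullback I 𝓘(ℝ, E)
      (extChartAt I c) (constVectorField (b k)) := by
    filter_upwards [(chartAt H c).open_source.mem_nhds hx] with y hy
      using coordFrame_eq_mpullback hy k
  rw [(h i).mlieBracket_vectorField_eq (h j)]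
  have hc (k : ι) : MDifferentiableAt 𝓘(ℝ, E) 𝓘(ℝ, E).tangent
      (T% (constVectorField (b k))) (extChartAt I c x) := by
    have : ContMDiffAt 𝓘(ℝ, E) 𝓘(ℝ, E).tangent ∞
      (T% (constVectorField (b k))) (extChartAt I c x) :=
      contMDiffAt_vectorSpace_iff_contDiffAt.2 contDiffAt_const
    exact this.mdifferentiableAt (by simp)
  have : IsManifold I (minSmoothness ℝ 3) M := by
    simpa using (inferInstance : IsManifold I 3 M)
  rw [← VectorField.mpullback_mlieBracket (n := ∞) (hc i) (hc j) (contMDiffAt_extChartAt' hx)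
    (by simp; norm_cast), VectorField.mpullback_apply]
  have : VectorField.mlieBracket 𝓘(ℝ, E) (constVectorField (b i))
      (constVectorField (b j)) (extChartAt I c x) = 0 := by
    rw [← VectorField.mlieBracketWithin_univ, VectorField.mlieBracketWithin_eq_lieBracketWithin]
    have key : VectorField.lieBracketWithin ℝ (fun _ : E ↦ b i) (fun _ : E ↦ b j) univ
      (extChartAt I c x) = 0 := by simp [VectorField.lieBracketWithin]
    exact key
  rw [this, map_zero]

/-- Coordinate derivatives are derivatives in the direction of the coordinate vector fields. -/
lemma mvfderiv_coordFrame [I.Boundaryless] {h : M → ℝ} (hx : x ∈ (chartAt H c).source)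
    (hh : MDiffAt h x) (k : ι) :
    mvfderiv I h x (coordFrame I b c k x) =
      fderiv ℝ (h ∘ (extChartAt I c).symm) (extChartAt I c x) (b k) := by
  have hx' : x ∈ (extChartAt I c).source := by rwa [extChartAt_source]
  have hs := mdifferentiableWithinAt_extChartAt_symm ((extChartAt I c).map_source hx')
  rw [ModelWithCorners.range_eq_univ, mdifferentiableWithinAt_univ] at hs
  have := mvfderiv_comp_apply_of_eq (extChartAt I c x) hh hs ((extChartAt I c).left_inv hx') (b k)
  rw [coordFrame_eq_mfderiv_symm hx]
  refine Eq.trans ?_ (this.symm.trans ?_)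
  · rfl
  · simp [mvfderiv, mfderiv_eq_fderiv]
    rfl

variable [Fintype ι]

lemma sum_coordCoeff (hx : x ∈ (chartAt H c).source) (v : TangentSpace I x) :
    ∑ i, coordCoeff I b c i x v • coordFrame I b c i x = v := by
  simp_rw [← coordBasis_repr hx, ← coordBasis_apply hx]
  exact (coordBasis I b hx).sum_repr v

lemma eventuallyEq_sum_coordCoeff (hx : x ∈ (chartAt H c).source)
    (X : Π x : M, TangentSpace I x) :
    ∀ᶠ y in 𝓝 x, X y = ∑ i, coordCoeff I b c i y (X y) • coordFrame I b c i y := by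
  filter_upwards [(chartAt H c).open_source.mem_nhds hx] with y hy
  exact (sum_coordCoeff hy _).symm

lemma trace_eq_sum_coordCoeff (hx : x ∈ (chartAt H c).source)
    (A : TangentSpace I x →ₗ[ℝ] TangentSpace I x) :
    LinearMap.trace ℝ _ A = ∑ i, coordCoeff I b c i x (A (coordFrame I b c i x)) := by
  classical
  rw [LinearMap.trace_eq_matrix_trace ℝ (coordBasis I b hx), Matrix.trace]
  simp [LinearMap.toMatrix_apply, coordBasis_repr, coordBasis_apply]

end CoordFrame

section SmoothMatrix

variable {E : Type*} [NormedAddCommGroup E] [NormedSpace ℝ E]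
  {H : Type*} [TopologicalSpace H] {I : ModelWithCorners ℝ E H}
  {M : Type*} [TopologicalSpace M] [ChartedSpace H M]
  {ι : Type*} [Fintype ι] [DecidableEq ι] {x : M}

lemma contMDiffAt_matrix_det {A : M → Matrix ι ι ℝ} (hA : ∀ i j, CMDiffAt ∞ (fun y ↦ A y i j) x) :
    CMDiffAt ∞ (fun y ↦ (A y).det) x := by
  simp only [Matrix.det_apply']
  exact contMDiffAt_finsetSum fun σ _ ↦ contMDiffAt_const.mul
    (contMDiffAt_finsetProd fun i _ ↦ hA _ _)

lemma contMDiffAt_matrix_inv {A : M → Matrix ι ι ℝ} (hA : ∀ i j, CMDiffAt ∞ (fun y ↦ A y i j) x)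
    (hx : (A x).det ≠ 0) (i j : ι) : CMDiffAt ∞ (fun y ↦ (A y)⁻¹ i j) x := by
  simp only [Matrix.inv_def, Matrix.smul_apply, Ring.inverse_eq_inv', smul_eq_mul,
    Matrix.adjugate_apply]
  refine ((contMDiffAt_matrix_det hA).inv₀ hx).mul (contMDiffAt_matrix_det fun k l ↦ ?_)
  by_cases hk : k = j
  · subst hk
    simpa using contMDiffAt_const
  · simpa [Matrix.updateRow_ne hk] using hA k l

end SmoothMatrix

section RiemannianFrame

variable {E : Type*} [NormedAddCommGroup E] [NormedSpace ℝ E] [FiniteDimensional ℝ E]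
  {H : Type*} [TopologicalSpace H] {I : ModelWithCorners ℝ E H}
  {M : Type*} [TopologicalSpace M] [ChartedSpace H M] [IsManifold I ∞ M]
  [RiemannianBundle (fun x : M ↦ TangentSpace I x)]

/-- The vector dual to a covector with respect to the metric. -/
def sharp (x : M) (α : TangentSpace I x →ₗ[ℝ] ℝ) : TangentSpace I x :=
  ∑ i, α (stdOrthonormalBasis ℝ (TangentSpace I x) i) • stdOrthonormalBasis ℝ (TangentSpace I x) i

lemma inner_sharp {x : M} (α : TangentSpace I x →ₗ[ℝ] ℝ) (v : TangentSpace I x) :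
    inner ℝ (sharp x α) v = α v := by
  conv_rhs => rw [← (stdOrthonormalBasis ℝ (TangentSpace I x)).sum_repr' v]
  simp only [sharp, sum_inner, inner_smul_left, map_sum, map_smul, smul_eq_mul, conj_trivial]
  exact Finset.sum_congr rfl fun i _ ↦ mul_comm _ _

lemma eq_sharp_iff {x : M} {α : TangentSpace I x →ₗ[ℝ] ℝ} {u : TangentSpace I x} :
    u = sharp x α ↔ ∀ v, inner ℝ u v = α v := by
  refine ⟨fun h v ↦ h ▸ inner_sharp α v, fun h ↦ ext_inner_right ℝ fun v ↦ ?_⟩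
  rw [h, inner_sharp]

variable {ι : Type*} {b : Module.Basis ι ℝ E} {c x : M}

variable (I b) in
/-- The Gram matrix of the coordinate vectors of the chart at `c`. -/
def coordGram (c x : M) : Matrix ι ι ℝ :=
  Matrix.gram ℝ fun i ↦ coordFrame I b c i x

lemma coordGram_posDef [Finite ι] (hx : x ∈ (chartAt H c).source) :
    (coordGram I b c x).PosDef := by
  refine Matrix.posDef_gram_of_linearIndependent ?_
  simp_rw [← coordBasis_apply hx]
  exact (coordBasis I b hx).linearIndependent

variable [IsContMDiffRiemannianBundle I ∞ E (fun x : M ↦ TangentSpace I x)]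

lemma contMDiffAt_inner {X Y : Π x : M, TangentSpace I x} (hX : CMDiffAt ∞ (T% X) x)
    (hY : CMDiffAt ∞ (T% Y) x) : CMDiffAt ∞ (fun y ↦ (inner ℝ (X y) (Y y) : ℝ)) x :=
  ContMDiffAt.inner_bundle (E := fun y : M ↦ TangentSpace I y) (b := fun y ↦ y) hX hY

lemma contMDiffAt_coordGram (hx : x ∈ (chartAt H c).source) (i j : ι) :
    CMDiffAt ∞ (fun y ↦ coordGram I b c y i j) x :=
  contMDiffAt_inner (contMDiffAt_coordFrame hx i) (contMDiffAt_coordFrame hx j)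

lemma contMDiffAt_sharp {α : Π x : M, TangentSpace I x →ₗ[ℝ] ℝ}
    (h : ∀ (c : M) (i : Fin (Module.finrank ℝ E)), x ∈ (chartAt H c).source →
      CMDiffAt ∞ (fun y ↦ α y (coordFrame I (Module.finBasis ℝ E) c i y)) x) :
    CMDiffAt ∞ (T% (fun y ↦ sharp y (α y))) x := by
  have hx := mem_chart_source H x
  rw [contMDiffAt_iff_coordCoeff (b := Module.finBasis ℝ E) hx]
  intro i
  have key : ∀ᶠ y in 𝓝 x, coordCoeff I (Module.finBasis ℝ E) x i y (sharp y (α y)) =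
      ∑ j, α y (coordFrame I (Module.finBasis ℝ E) x j y) *
        (coordGram I (Module.finBasis ℝ E) x y)⁻¹ j i := by
    filter_upwards [(chartAt H x).open_source.mem_nhds hx] with y hy
    set G := coordGram I (Module.finBasis ℝ E) x y
    have h1 : Matrix.vecMul (fun k ↦ coordCoeff I (Module.finBasis ℝ E) x k y (sharp y (α y))) G =
        fun j ↦ α y (coordFrame I (Module.finBasis ℝ E) x j y) := by
      ext j
      rw [← inner_sharp (α y), ← sum_coordCoeff (b := Module.finBasis ℝ E) hy (sharp y (α y))]
      conv_rhs => rw [sum_inner]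
      rw [sum_coordCoeff hy]
      simp only [inner_smul_left, conj_trivial]
      rfl
    have hG : IsUnit G.det := (coordGram_posDef hy).det_pos.ne'.isUnit
    have h2 := congr_fun (congr_arg (fun v ↦ Matrix.vecMul v G⁻¹) h1) i
    rw [Matrix.vecMul_vecMul, Matrix.mul_nonsing_inv _ hG, Matrix.vecMul_one] at h2
    exact h2
  refine ContMDiffAt.congr_of_eventuallyEq ?_ key
  exact contMDiffAt_finsetSum fun j _ ↦ (h x j hx).mul
    (contMDiffAt_matrix_inv (fun _ _ ↦ contMDiffAt_coordGram hx _ _)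
      (coordGram_posDef hx).det_pos.ne' _ _)

lemma isSmooth_inner {Z : Π x : M, TangentSpace I x} (hZ : CMDiff ∞ (T% Z)) :
    OneForm.IsSmooth (I := I) (M := M) fun x ↦ innerSL ℝ (Z x) := by
  obtain ⟨g, hg, hgi⟩ := ‹IsContMDiffRiemannianBundle I ∞ E
    (fun x : M ↦ TangentSpace I x)›.exists_contMDiff
  have : (fun x : M ↦ (innerSL ℝ (Z x) : TangentSpace I x →L[ℝ] ℝ)) = fun x ↦ g x (Z x) := by
    ext x v
    exact hgi x _ _
  rw [this]
  exact ContMDiff.clm_bundle_apply (F₁ := E) (F₂ := E →L[ℝ] ℝ)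
    (E₁ := fun x : M ↦ TangentSpace I x) (E₂ := fun x : M ↦ TangentSpace I x →L[ℝ] ℝ)
    (b := fun x ↦ x) hg hZ

lemma leviCivita_coordFrame_comm [I.Boundaryless] (hx : x ∈ (chartAt H c).source) (i j : ι) :
    leviCivita I M (coordFrame I b c i) x (coordFrame I b c j x) =
      leviCivita I M (coordFrame I b c j) x (coordFrame I b c i x) := by
  have h := (CovariantDerivative.torsion_eq_zero_iff _).1 (leviCivita_torsion (I := I) (M := M))
    (mdifferentiableAt_coordFrame (b := b) hx j) (mdifferentiableAt_coordFrame (b := b) hx i)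
  rwa [mlieBracket_coordFrame hx, sub_eq_zero] at h

lemma leviCivita_congr {X Y : Π x : M, TangentSpace I x} (hX : MDiffAt (T% X) x)
    (hY : MDiffAt (T% Y) x) (h : X =ᶠ[𝓝 x] Y) : leviCivita I M X x = leviCivita I M Y x :=
  (leviCivita I M).isCovariantDerivativeOnUniv.congr_of_eventuallyEq hX hY univ_mem h

lemma leviCivita_sum {κ : Type*} (s : Finset κ) {f : κ → M → ℝ}
    {X : κ → Π x : M, TangentSpace I x} (hf : ∀ i ∈ s, MDiffAt (f i) x)
    (hX : ∀ i ∈ s, MDiffAt (T% (X i)) x) :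
    MDiffAt (T% (fun y ↦ ∑ i ∈ s, f i y • X i y)) x ∧
    ∀ v, leviCivita I M (fun y ↦ ∑ i ∈ s, f i y • X i y) x v =
      ∑ i ∈ s, (f i x • leviCivita I M (X i) x v + mvfderiv I (f i) x v • X i x) := by
  classical
  have cov := (leviCivita I M).isCovariantDerivativeOnUniv
  induction s using Finset.induction_on with
  | empty =>
    refine ⟨by simpa using! (mdifferentiableAt_zeroSection (𝕜 := ℝ) (F := E)
      (E := fun x : M ↦ TangentSpace I x) (IB := I)), fun v ↦ ?_⟩
    have : leviCivita I M 0 x = 0 := cov.zero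
    simp only [Finset.sum_empty]
    exact DFunLike.congr_fun this v
  | insert k s hk ih =>
    obtain ⟨h1, h2⟩ := ih (fun i hi ↦ hf i (Finset.mem_insert_of_mem hi))
      (fun i hi ↦ hX i (Finset.mem_insert_of_mem hi))
    have hfk := hf k (Finset.mem_insert_self _ _)
    have hXk := hX k (Finset.mem_insert_self _ _)
    have h3 : MDiffAt (T% (f k • X k)) x := hfk.smul_section hXk
    have e : (fun y ↦ ∑ i ∈ insert k s, f i y • X i y) =
        f k • X k + fun y ↦ ∑ i ∈ s, f i y • X i y := by
      ext y
      simp [Finset.sum_insert hk]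
    have h6 := mdifferentiableAt_add_section h3 h1
    rw [← e] at h6
    refine ⟨h6, fun v ↦ ?_⟩
    rw [e]
    have h4 : leviCivita I M (f k • X k + fun y ↦ ∑ i ∈ s, f i y • X i y) x =
      leviCivita I M (f k • X k) x + leviCivita I M (fun y ↦ ∑ i ∈ s, f i y • X i y) x :=
      cov.add h3 h1
    have h5 : leviCivita I M (f k • X k) x =
      f k x • leviCivita I M (X k) x + (mvfderiv I (f k) x).smulRight (X k x) :=
      cov.leibniz hXk hfk
    rw [h4, h5, Finset.sum_insert hk, ← h2]
    simp

lemma coordCoeff_coordFrame [DecidableEq ι] (hx : x ∈ (chartAt H c).source) (i j : ι) :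
    coordCoeff I b c i x (coordFrame I b c j x) = if j = i then 1 else 0 := by
  rw [← coordBasis_repr hx, ← coordBasis_apply hx, Module.Basis.repr_self, Finsupp.single_apply]

/-- The components of the covariant derivative of a vector field in terms of the components of the
vector field. -/
lemma coordCoeff_leviCivita [Fintype ι] (hx : x ∈ (chartAt H c).source)
    {X : Π x : M, TangentSpace I x} (hX : MDiffAt (T% X) x) (v : TangentSpace I x) (j : ι) :
    coordCoeff I b c j x (leviCivita I M X x v) =
      mvfderiv I (fun y ↦ coordCoeff I b c j y (X y)) x v + ∑ i, coordCoeff I b c i x (X x) *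
        coordCoeff I b c j x (leviCivita I M (coordFrame I b c i) x v) := by
  classical
  obtain ⟨h1, h2⟩ := leviCivita_sum (x := x) Finset.univ
    (f := fun i y ↦ coordCoeff I b c i y (X y)) (X := coordFrame I b c)
    (fun i _ ↦ mdifferentiableAt_coordCoeff hx hX i) (fun i _ ↦ mdifferentiableAt_coordFrame hx i)
  rw [leviCivita_congr hX h1 (eventuallyEq_sum_coordCoeff hx X), h2]
  simp [map_sum, coordCoeff_coordFrame hx, Finset.sum_add_distrib, add_comm]

end RiemannianFrame

section TensorCalculus

variable {E : Type*} [NormedAddCommGroup E] [NormedSpace ℝ E] [FiniteDimensional ℝ E]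
  {H : Type*} [TopologicalSpace H] {I : ModelWithCorners ℝ E H}
  {M : Type*} [TopologicalSpace M] [ChartedSpace H M] [IsManifold I ∞ M]

section
variable {θ : OneForm I M} {φ : BilinForm I M} {x : M} {Y Z : Π x : M, TangentSpace I x}

lemma OneForm.IsSmooth.contMDiffAt_apply (hθ : θ.IsSmooth) (hY : CMDiffAt ∞ (T% Y) x) :
    CMDiffAt ∞ (fun y ↦ θ y (Y y)) x := by
  have h : ContMDiffAt I (I.prod 𝓘(ℝ, ℝ)) ∞
      (fun y ↦ TotalSpace.mk' ℝ (E := Bundle.Trivial M ℝ) y (θ y (Y y))) x :=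
    ContMDiffAt.clm_bundle_apply (F₁ := E) (F₂ := ℝ)
      (E₁ := fun x : M ↦ TangentSpace I x) (E₂ := Bundle.Trivial M ℝ) (b := fun y ↦ y) (hθ x) hY
  simp only [contMDiffAt_totalSpace] at h
  exact h.2

lemma BilinForm.IsSmooth.contMDiffAt_apply (hφ : φ.IsSmooth) (hY : CMDiffAt ∞ (T% Y) x)
    (hZ : CMDiffAt ∞ (T% Z) x) : CMDiffAt ∞ (fun y ↦ φ y (Y y) (Z y)) x := by
  have h : ContMDiffAt I (I.prod 𝓘(ℝ, ℝ)) ∞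
      (fun y ↦ TotalSpace.mk' ℝ (E := Bundle.Trivial M ℝ) y (φ y (Y y) (Z y))) x :=
    ContMDiffAt.clm_bundle_apply₂ (F₁ := E) (F₂ := E) (F₃ := ℝ)
      (E₁ := fun x : M ↦ TangentSpace I x) (E₂ := fun x : M ↦ TangentSpace I x)
      (E₃ := Bundle.Trivial M ℝ) (b := fun y ↦ y) (hφ x) hY hZ
  simp only [contMDiffAt_totalSpace] at h
  exact h.2

end

lemma mvfderiv_congr {f g : M → ℝ} {x : M} (h : f =ᶠ[𝓝 x] g) :
    mvfderiv I f x = mvfderiv I g x := by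
  ext v
  exact DFunLike.congr_fun (h.mfderiv_eq (I := I) (I' := 𝓘(ℝ, ℝ))) v

lemma mvfderiv_finset_sum {κ : Type} (s : Finset κ) {f : κ → M → ℝ} {x : M}
    (hf : ∀ i ∈ s, MDiffAt (f i) x) (v : TangentSpace I x) :
    mvfderiv I (fun y ↦ ∑ i ∈ s, f i y) x v = ∑ i ∈ s, mvfderiv I (f i) x v := by
  classical
  induction s using Finset.induction_on with
  | empty => simp [mvfderiv_const]
  | insert k s hk ih =>
    have hs := fun i hi ↦ hf i (Finset.mem_insert_of_mem hi)
    simp only [Finset.sum_insert hk]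
    rw [mvfderiv_fun_add (hf k (Finset.mem_insert_self _ _)) ?_,
      add_apply, ih hs]
    have := MDifferentiableAt.sum (I := I) (t := s) (f := f) hs
    rwa [Finset.sum_fn] at this

variable [RiemannianBundle (fun x : M ↦ TangentSpace I x)]

/-- The endomorphism associated to a bilinear form by the metric. -/
def sharpEnd (x : M) (B : TangentSpace I x →ₗ[ℝ] TangentSpace I x →ₗ[ℝ] ℝ) :
    TangentSpace I x →ₗ[ℝ] TangentSpace I x where
  toFun v := sharp x (B v)
  map_add' v w := by simp [sharp, add_smul, Finset.sum_add_distrib]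
  map_smul' r v := by simp [sharp, mul_smul, Finset.smul_sum]

lemma trace_sharpEnd (x : M) (B : TangentSpace I x →ₗ[ℝ] TangentSpace I x →ₗ[ℝ] ℝ) :
    LinearMap.trace ℝ _ (sharpEnd x B) = ∑ i, B (stdOrthonormalBasis ℝ (TangentSpace I x) i)
      (stdOrthonormalBasis ℝ (TangentSpace I x) i) := by
  rw [LinearMap.trace_eq_sum_inner _ (stdOrthonormalBasis ℝ (TangentSpace I x))]
  refine Finset.sum_congr rfl fun i _ ↦ ?_
  rw [real_inner_comm]
  exact inner_sharp _ _

/-- A bilinear form as an algebraic bilinear map. -/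
def BilinForm.toLin₂ (φ : BilinForm I M) (x : M) :
    TangentSpace I x →ₗ[ℝ] TangentSpace I x →ₗ[ℝ] ℝ :=
  LinearMap.mk₂ ℝ (fun v w ↦ φ x v w) (by simp) (by simp) (by simp) (by simp)

variable [IsContMDiffRiemannianBundle I ∞ E (fun x : M ↦ TangentSpace I x)]
  {θ : OneForm I M} {φ : BilinForm I M} {x : M} {X Y Z : Π x : M, TangentSpace I x}

lemma mvfderiv_inner (u : TangentSpace I x) (hY : MDiffAt (T% Y) x) (hZ : MDiffAt (T% Z) x) :
    mvfderiv I (fun y ↦ (inner ℝ (Y y) (Z y) : ℝ)) x u =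
      inner ℝ (leviCivita I M Y x u) (Z x) + inner ℝ (Y x) (leviCivita I M Z x u) := by
  have := leviCivita_metric (FiberBundle.mdifferentiableAt_extend I E u) hY hZ
  rwa [FiberBundle.extend_apply_self] at this

lemma inner_leviCivita_sharp {α : Π x : M, TangentSpace I x →ₗ[ℝ] ℝ}
    (hα : MDiffAt (T% (fun y ↦ sharp y (α y))) x) (hZ : MDiffAt (T% Z) x) (u : TangentSpace I x) :
    inner ℝ (leviCivita I M (fun y ↦ sharp y (α y)) x u) (Z x) =
      mvfderiv I (fun y ↦ α y (Z y)) x u - α x (leviCivita I M Z x u) := by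
  have := mvfderiv_inner u hα hZ
  simp only [inner_sharp] at this
  rw [this]
  ring

lemma BilinForm.covDeriv_add_right (hφ : φ.IsSmooth) (u v w w' : TangentSpace I x) :
    φ.covDeriv x u v (w + w') = φ.covDeriv x u v w + φ.covDeriv x u v w' := by
  have hV := FiberBundle.mdifferentiableAt_extend I E v
  have hW := FiberBundle.mdifferentiableAt_extend I E w
  have hW' := FiberBundle.mdifferentiableAt_extend I E w'
  have h := covDeriv_apply hφ u hV (mdifferentiableAt_add_section hW hW')
  have h1 := covDeriv_apply hφ u hV hW
  have h2 := covDeriv_apply hφ u hV hW'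
  have e : leviCivita I M (FiberBundle.extend E w + FiberBundle.extend E w') x =
    leviCivita I M (FiberBundle.extend E w) x + leviCivita I M (FiberBundle.extend E w') x :=
    (leviCivita I M).isCovariantDerivativeOnUniv.add hW hW'
  rw [e] at h
  simp only [Pi.add_apply, map_add, FiberBundle.extend_apply_self, add_apply,
    mvfderiv_fun_add (hφ.mdifferentiableAt_apply hV hW) (hφ.mdifferentiableAt_apply hV hW')]
    at h h1 h2
  rw [h, h1, h2]
  ring

lemma BilinForm.covDeriv_smul_right (hφ : φ.IsSmooth) (r : ℝ) (u v w : TangentSpace I x) :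
    φ.covDeriv x u v (r • w) = r * φ.covDeriv x u v w := by
  have hV := FiberBundle.mdifferentiableAt_extend I E v
  have hW := FiberBundle.mdifferentiableAt_extend I E w
  have hr : MDiffAt (fun _ : M ↦ r) x := mdifferentiableAt_const
  have h := covDeriv_apply hφ u hV (hr.smul_section hW)
  have h1 := covDeriv_apply hφ u hV hW
  have e : leviCivita I M ((fun _ ↦ r) • FiberBundle.extend E w) x =
    r • leviCivita I M (FiberBundle.extend E w) x +
      (mvfderiv I (fun _ ↦ r) x).smulRight (FiberBundle.extend E w x) :=
    (leviCivita I M).isCovariantDerivativeOnUniv.leibniz hW hr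
  rw [e] at h
  simp only [Pi.smul_apply', map_smul, FiberBundle.extend_apply_self, add_apply, smul_apply,
    mvfderiv_const, smul_eq_mul,
    mvfderiv_fun_mul hr (hφ.mdifferentiableAt_apply hV hW)] at h h1
  rw [h, h1]
  simp
  ring

lemma BilinForm.IsSmoothSymm.covDeriv_symm (hφ : φ.IsSmoothSymm) (u v w : TangentSpace I x) :
    φ.covDeriv x u v w = φ.covDeriv x u w v := by
  simp only [BilinForm.covDeriv, hφ.symm _ v, hφ.symm _ _ w]
  simp only [hφ.symm _ (FiberBundle.extend E v _)]
  ring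

/-- The covariant derivative of a smooth symmetric form in the direction of a vector, as a bilinear
map. -/
def BilinForm.IsSmoothSymm.covDerivLin₂ (hφ : φ.IsSmoothSymm) (u : TangentSpace I x) :
    TangentSpace I x →ₗ[ℝ] TangentSpace I x →ₗ[ℝ] ℝ :=
  LinearMap.mk₂ ℝ (φ.covDeriv x u)
    (fun v v' w ↦ by
      simp only [hφ.covDeriv_symm u _ w, BilinForm.covDeriv_add_right hφ.smooth])
    (fun r v w ↦ by
      simp only [hφ.covDeriv_symm u _ w, BilinForm.covDeriv_smul_right hφ.smooth, smul_eq_mul])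
    (BilinForm.covDeriv_add_right hφ.smooth u)
    (fun r v w ↦ BilinForm.covDeriv_smul_right hφ.smooth r u v w)

/-- The divergence of a vector field. -/
def divergence (X : Π x : M, TangentSpace I x) (x : M) : ℝ :=
  LinearMap.trace ℝ (TangentSpace I x) (leviCivita I M X x).toLinearMap

lemma divergence_eq_sum_inner (X : Π x : M, TangentSpace I x) (x : M) :
    divergence X x = ∑ i, inner ℝ (leviCivita I M X x (stdOrthonormalBasis ℝ (TangentSpace I x) i))
      (stdOrthonormalBasis ℝ (TangentSpace I x) i) := by
  rw [divergence, LinearMap.trace_eq_sum_inner _ (stdOrthonormalBasis ℝ (TangentSpace I x))]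
  exact Finset.sum_congr rfl fun i _ ↦ real_inner_comm _ _

/-- The vector field dual to a one-form. -/
def OneForm.dual (θ : OneForm I M) (x : M) : TangentSpace I x := sharp x (θ x).toLinearMap

/-- The vector field `X` with `g(X, V) = φ(V, Y)` for all `V`. -/
def BilinForm.contract (φ : BilinForm I M) (Y : Π x : M, TangentSpace I x) (x : M) :
    TangentSpace I x := sharp x ((φ.toLin₂ x).flip (Y x))

lemma OneForm.IsSmooth.contMDiff_dual (hθ : θ.IsSmooth) : CMDiff ∞ (T% θ.dual) := fun _ ↦
  contMDiffAt_sharp fun _ _ hx ↦ hθ.contMDiffAt_apply (contMDiffAt_coordFrame hx _)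

lemma BilinForm.IsSmooth.contMDiff_contract (hφ : φ.IsSmooth) (hY : CMDiff ∞ (T% Y)) :
    CMDiff ∞ (T% (φ.contract Y)) := fun x ↦
  contMDiffAt_sharp fun _ _ hx ↦ hφ.contMDiffAt_apply (contMDiffAt_coordFrame hx _) (hY x)

/-- The divergence of `φ(·, θ)`, as the sum of the pairings of `φ` with `∇θ` and of the divergence
of `φ` with `θ`. -/
lemma divergence_contract_dual (hφ : φ.IsSmooth) (hθ : θ.IsSmooth) (x : M) :
    divergence (φ.contract θ.dual) x = bilinInner I x (fun u v ↦ φ x u v) (θ.extDeriv x) +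
      covectorInner I x (fun v ↦ ∑ i, φ.covDeriv x (stdOrthonormalBasis ℝ (TangentSpace I x) i)
        (stdOrthonormalBasis ℝ (TangentSpace I x) i) v) (θ x) := by
  have hY := (hθ.contMDiff_dual x).mdifferentiableAt (n := ∞) (by simp)
  have hX := (hφ.contMDiff_contract hθ.contMDiff_dual x).mdifferentiableAt (n := ∞) (by simp)
  have hE (v : TangentSpace I x) := FiberBundle.mdifferentiableAt_extend I E v
  have h1 (u v : TangentSpace I x) : inner ℝ (leviCivita I M θ.dual x u) v = θ.extDeriv x u v := by
    have := inner_leviCivita_sharp (α := fun x ↦ (θ x).toLinearMap) hY (hE v) u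
    rw [FiberBundle.extend_apply_self] at this
    exact this
  have h2 (u v : TangentSpace I x) : inner ℝ (leviCivita I M (φ.contract θ.dual) x u) v =
      φ.covDeriv x u v (θ.dual x) + φ x v (leviCivita I M θ.dual x u) := by
    have h3 := inner_leviCivita_sharp (α := fun x ↦ (φ.toLin₂ x).flip (θ.dual x)) hX (hE v) u
    have h4 := BilinForm.covDeriv_apply hφ u (hE v) hY
    rw [FiberBundle.extend_apply_self] at h3 h4
    rw [h4]
    exact h3.trans (by simp [BilinForm.toLin₂])
  have h5 (u : TangentSpace I x) : φ x u (leviCivita I M θ.dual x u) =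
      ∑ j, φ x u (stdOrthonormalBasis ℝ (TangentSpace I x) j) *
        θ.extDeriv x u (stdOrthonormalBasis ℝ (TangentSpace I x) j) := by
    conv_lhs => rw [← (stdOrthonormalBasis ℝ (TangentSpace I x)).sum_repr'
      (leviCivita I M θ.dual x u)]
    simp only [map_sum, map_smul, smul_eq_mul]
    refine Finset.sum_congr rfl fun j _ ↦ ?_
    rw [← h1, mul_comm, real_inner_comm]
  have h6 (u v : TangentSpace I x) : φ.covDeriv x u v (θ.dual x) =
      ∑ j, φ.covDeriv x u v (stdOrthonormalBasis ℝ (TangentSpace I x) j) *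
        θ x (stdOrthonormalBasis ℝ (TangentSpace I x) j) := by
    let L : TangentSpace I x →ₗ[ℝ] ℝ :=
      { toFun := φ.covDeriv x u v
        map_add' := BilinForm.covDeriv_add_right hφ u v
        map_smul' := fun r w ↦ BilinForm.covDeriv_smul_right hφ r u v w }
    change L _ = ∑ j, L _ * _
    rw [OneForm.dual, sharp, map_sum]
    refine Finset.sum_congr rfl fun j _ ↦ ?_
    rw [map_smul, smul_eq_mul, mul_comm]
    rfl
  rw [divergence_eq_sum_inner]
  simp only [h2, h5, h6, Finset.sum_add_distrib, bilinInner, covectorInner, Finset.sum_mul]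
  rw [add_comm]
  congr 1
  exact Finset.sum_comm

lemma BilinForm.trace_eq (φ : BilinForm I M) (x : M) :
    φ.trace x = LinearMap.trace ℝ _ (sharpEnd x (φ.toLin₂ x)) :=
  (trace_sharpEnd x (φ.toLin₂ x)).symm

lemma contMDiffAt_sharpEnd (hφ : φ.IsSmooth) (hY : CMDiffAt ∞ (T% Y) x) :
    CMDiffAt ∞ (T% (fun y ↦ sharpEnd y (φ.toLin₂ y) (Y y))) x :=
  contMDiffAt_sharp fun _ _ hx ↦ hφ.contMDiffAt_apply hY (contMDiffAt_coordFrame hx _)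

lemma BilinForm.trace_eventuallyEq (φ : BilinForm I M) (x : M) :
    φ.trace =ᶠ[𝓝 x] fun y ↦ ∑ i, coordCoeff I (Module.finBasis ℝ E) x i y
      (sharpEnd y (φ.toLin₂ y) (coordFrame I (Module.finBasis ℝ E) x i y)) := by
  filter_upwards [(chartAt H x).open_source.mem_nhds (mem_chart_source H x)] with y hy
  rw [φ.trace_eq, trace_eq_sum_coordCoeff (b := Module.finBasis ℝ E) hy]

lemma BilinForm.IsSmooth.contMDiff_trace (hφ : φ.IsSmooth) : CMDiff ∞ φ.trace := by
  intro x
  have hx := mem_chart_source H x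
  refine ContMDiffAt.congr_of_eventuallyEq ?_ (φ.trace_eventuallyEq x)
  exact contMDiffAt_finsetSum fun i _ ↦ (contMDiffAt_iff_coordCoeff hx).1
    (contMDiffAt_sharpEnd hφ (contMDiffAt_coordFrame hx i)) i

/-- The derivative of the trace is the trace of the covariant derivative. -/
lemma BilinForm.IsSmoothSymm.mvfderiv_trace (hφ : φ.IsSmoothSymm) (w : TangentSpace I x) :
    mvfderiv I φ.trace x w = ∑ i, φ.covDeriv x w (stdOrthonormalBasis ℝ (TangentSpace I x) i)
      (stdOrthonormalBasis ℝ (TangentSpace I x) i) := by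
  set b := Module.finBasis ℝ E
  have hx := mem_chart_source H x
  set B := coordFrame I b x with hB
  have hBd (i) : MDiffAt (T% (B i)) x := mdifferentiableAt_coordFrame hx i
  set S : _ → Π y : M, TangentSpace I y := fun i y ↦ sharpEnd y (φ.toLin₂ y) (B i y) with hS
  have hSd (i) : MDiffAt (T% (S i)) x :=
    (contMDiffAt_sharpEnd hφ.smooth (contMDiffAt_coordFrame hx i)).mdifferentiableAt (n := ∞)
      (by simp)
  have h1 (i) : leviCivita I M (S i) x w = sharpEnd x (hφ.covDerivLin₂ w) (B i x) +
      sharpEnd x (φ.toLin₂ x) (leviCivita I M (B i) x w) := by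
    refine ext_inner_right ℝ fun v ↦ ?_
    have hV := FiberBundle.mdifferentiableAt_extend I E v
    have h2 := inner_leviCivita_sharp (α := fun y ↦ φ.toLin₂ y (B i y)) (hSd i) hV w
    have h3 := BilinForm.covDeriv_apply hφ.smooth w (hBd i) hV
    rw [FiberBundle.extend_apply_self] at h2 h3
    have h4 : inner ℝ (sharpEnd x (hφ.covDerivLin₂ w) (B i x)) v = φ.covDeriv x w (B i x) v :=
      inner_sharp _ _
    have h5 : inner ℝ (sharpEnd x (φ.toLin₂ x) (leviCivita I M (B i) x w)) v =
      φ x (leviCivita I M (B i) x w) v := inner_sharp _ _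
    rw [inner_add_left, h4, h5, h3]
    refine h2.trans ?_
    simp only [BilinForm.toLin₂, LinearMap.mk₂_apply]
    ring
  have h6 : mvfderiv I φ.trace x w =
      ∑ i, mvfderiv I (fun y ↦ coordCoeff I b x i y (S i y)) x w := by
    have hd (i) : MDiffAt (fun y ↦ coordCoeff I b x i y (S i y)) x :=
      mdifferentiableAt_coordCoeff hx (hSd i) i
    rw [mvfderiv_congr (φ.trace_eventuallyEq x), mvfderiv_finset_sum _ fun i _ ↦ hd i]
  have h7 := trace_eq_sum_coordCoeff (b := b) hx (sharpEnd x (hφ.covDerivLin₂ w))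
  rw [trace_sharpEnd] at h7
  refine Eq.trans ?_ h7.symm
  have h8 (i) := coordCoeff_leviCivita (b := b) hx (hSd i) w i
  have h9 (i) : coordCoeff I b x i x (sharpEnd x (φ.toLin₂ x) (leviCivita I M (B i) x w)) =
      ∑ j, coordCoeff I b x j x (leviCivita I M (B i) x w) * coordCoeff I b x i x (S j x) := by
    conv_lhs => rw [← sum_coordCoeff (b := b) hx (leviCivita I M (B i) x w)]
    simp only [map_sum, map_smul, smul_eq_mul]
    rfl
  simp only [h1, map_add, h9] at h8
  rw [h6]
  have h10 := congr_arg (fun f : Fin _ → ℝ ↦ ∑ i, f i) (funext h8)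
  simp only [Finset.sum_add_distrib] at h10
  rw [Finset.sum_comm (f := fun i j ↦ coordCoeff I b x j x (leviCivita I M (B i) x w) *
    coordCoeff I b x i x (S j x))] at h10
  simp only [mul_comm (coordCoeff I b x _ x (S _ x))] at h10
  simp only [← hB] at h10 ⊢
  linarith

end TensorCalculus

section Jacobi

variable {ι : Type*} [Fintype ι] [DecidableEq ι]

/-- Jacobi's formula for the derivative of a determinant. -/
lemma hasDerivAt_det {A : ℝ → Matrix ι ι ℝ} {A' : Matrix ι ι ℝ} {t : ℝ}
    (hA : ∀ i j, HasDerivAt (fun s ↦ A s i j) (A' i j) t) (hdet : IsUnit (A t).det) :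
    HasDerivAt (fun s ↦ (A s).det) ((A t).det * ((A t)⁻¹ * A').trace) t := by
  let D : (ι → ι → ℝ) → ℝ := fun B ↦ (Matrix.of B).det
  have hD : Differentiable ℝ D := by
    intro B
    simp only [D, Matrix.det_apply', Matrix.of_apply]
    fun_prop
  let a : ι → ι → ℝ := fun i j ↦ A t i j
  let a' : ι → ι → ℝ := fun i j ↦ A' i j
  have h1 : HasDerivAt (fun s ↦ D (fun i j ↦ A s i j)) (fderiv ℝ D a a') t :=
    HasFDerivAt.comp_hasDerivAt (f := fun s i j ↦ A s i j) t (hD a).hasFDerivAt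
      (hasDerivAt_pi.2 fun i ↦ hasDerivAt_pi.2 fun j ↦ hA i j)
  have h2 : HasDerivAt (fun s : ℝ ↦ D (a + s • a')) (fderiv ℝ D a a') 0 := by
    refine HasFDerivAt.comp_hasDerivAt (f := fun s : ℝ ↦ a + s • a') (0 : ℝ) ?_ ?_
    · rw [zero_smul, add_zero]
      exact (hD a).hasFDerivAt
    · simpa using ((hasDerivAt_id (0 : ℝ)).smul_const a').const_add a
  have h3 : HasDerivAt (fun s : ℝ ↦ D (a + s • a'))
      ((A t).det * ((A t)⁻¹ * A').trace) 0 := by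
    have e (s : ℝ) : D (a + s • a') = (A t).det *
        (1 + ((A t)⁻¹ * A').trace * s + (Matrix.det (1 + (Polynomial.X : Polynomial ℝ) •
          ((A t)⁻¹ * A').map Polynomial.C)).divX.divX.eval s * s ^ 2) := by
      rw [← Matrix.det_one_add_smul, ← Matrix.det_mul, mul_add, mul_one, Matrix.mul_smul,
        Matrix.mul_nonsing_inv_cancel_left _ _ hdet]
      rfl
    simp_rw [e]
    set q := (Matrix.det (1 + (Polynomial.X : Polynomial ℝ) •
          ((A t)⁻¹ * A').map Polynomial.C)).divX.divX
    have := ((((hasDerivAt_id (0 : ℝ)).const_mul ((A t)⁻¹ * A').trace).const_add 1).add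
      ((q.hasDerivAt 0).mul ((hasDerivAt_id (0 : ℝ)).pow 2))).const_mul (A t).det
    simpa using this
  rwa [h2.unique h3] at h1

end Jacobi

section VolumeDensity

variable {E : Type*} [NormedAddCommGroup E] [NormedSpace ℝ E] [FiniteDimensional ℝ E]
  {H : Type*} [TopologicalSpace H] {I : ModelWithCorners ℝ E H} [I.Boundaryless]
  {M : Type*} [TopologicalSpace M] [ChartedSpace H M] [IsManifold I ∞ M]
  {ι : Type*} {b : Module.Basis ι ℝ E} {c x : M}

lemma contDiffAt_comp_extChartAt_symm {h : M → ℝ} {p : E} (hp : p ∈ (extChartAt I c).target)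
    (hh : CMDiffAt ∞ h ((extChartAt I c).symm p)) :
    ContDiffAt ℝ ∞ (h ∘ (extChartAt I c).symm) p := by
  have h1 := ((contMDiffOn_extChartAt_symm (I := I) (n := ∞) c) p hp).contMDiffAt
    ((isOpen_extChartAt_target c).mem_nhds hp)
  exact (hh.comp p h1).contDiffAt

lemma hasFDerivAt_comp_extChartAt_symm {h : M → ℝ} (hx : x ∈ (chartAt H c).source)
    (hh : MDiffAt h x) : HasFDerivAt (h ∘ (extChartAt I c).symm)
      (fderiv ℝ (h ∘ (extChartAt I c).symm) (extChartAt I c x)) (extChartAt I c x) := by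
  have hx' : x ∈ (extChartAt I c).source := by rwa [extChartAt_source]
  have hs := mdifferentiableWithinAt_extChartAt_symm ((extChartAt I c).map_source hx')
  rw [ModelWithCorners.range_eq_univ, mdifferentiableWithinAt_univ] at hs
  have := MDifferentiableAt.comp_of_eq (extChartAt I c x) hh hs ((extChartAt I c).left_inv hx')
  exact (mdifferentiableAt_iff_differentiableAt.1 this).hasFDerivAt

lemma hasDerivAt_coordLine {h : M → ℝ} (hx : x ∈ (chartAt H c).source) (hh : MDiffAt h x) (k : ι) :
    HasDerivAt (fun t : ℝ ↦ h ((extChartAt I c).symm (extChartAt I c x + t • b k)))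
      (mvfderiv I h x (coordFrame I b c k x)) 0 := by
  rw [mvfderiv_coordFrame hx hh]
  refine HasFDerivAt.comp_hasDerivAt (l := h ∘ (extChartAt I c).symm)
    (f := fun t : ℝ ↦ extChartAt I c x + t • b k) 0 ?_ ?_
  · simpa using hasFDerivAt_comp_extChartAt_symm hx hh
  · simpa using ((hasDerivAt_id (0 : ℝ)).smul_const (b k)).const_add (extChartAt I c x)

variable [RiemannianBundle (fun x : M ↦ TangentSpace I x)]
  [IsContMDiffRiemannianBundle I ∞ E (fun x : M ↦ TangentSpace I x)]
  [Fintype ι] [DecidableEq ι]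

variable (I b) in
/-- The density of the Riemannian volume in the coordinates of the chart at `c`. -/
def volumeDensity (c x : M) : ℝ := √(coordGram I b c x).det

lemma volumeDensity_pos (hx : x ∈ (chartAt H c).source) : 0 < volumeDensity I b c x :=
  Real.sqrt_pos.2 (coordGram_posDef hx).det_pos

lemma contMDiffAt_volumeDensity (hx : x ∈ (chartAt H c).source) :
    CMDiffAt ∞ (volumeDensity I b c) x :=
  (Real.contDiffAt_sqrt (coordGram_posDef hx).det_pos.ne').contMDiffAt.comp x
    (contMDiffAt_matrix_det fun i j ↦ contMDiffAt_coordGram hx i j)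

lemma mvfderiv_coordGram (hx : x ∈ (chartAt H c).source) (v : TangentSpace I x) :
    (Matrix.of fun i j ↦ mvfderiv I (fun y ↦ coordGram I b c y i j) x v) =
      (Matrix.of fun i l ↦ coordCoeff I b c l x (leviCivita I M (coordFrame I b c i) x v)) *
        coordGram I b c x + coordGram I b c x *
      (Matrix.of fun i l ↦ coordCoeff I b c l x
        (leviCivita I M (coordFrame I b c i) x v)).transpose := by
  ext i j
  have h : mvfderiv I (fun y ↦ (inner ℝ (coordFrame I b c i y) (coordFrame I b c j y) : ℝ)) x v = _ :=
    mvfderiv_inner v (mdifferentiableAt_coordFrame (I := I) (b := b) hx i)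
    (mdifferentiableAt_coordFrame (I := I) (b := b) hx j)
  refine h.trans ?_
  rw [Matrix.add_apply, Matrix.mul_apply, Matrix.mul_apply]
  conv_lhs =>
    rw [← sum_coordCoeff (b := b) hx (leviCivita I M (coordFrame I b c i) x v),
      ← sum_coordCoeff (b := b) hx (leviCivita I M (coordFrame I b c j) x v)]
  simp only [sum_inner, inner_sum, inner_smul_left, inner_smul_right, conj_trivial,
    Matrix.of_apply, Matrix.transpose_apply, coordGram, Matrix.gram_apply]
  congr 1
  exact Finset.sum_congr rfl fun _ _ ↦ mul_comm _ _

/-- The logarithmic derivative of the volume density is the trace of the Christoffel symbols. -/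
lemma mvfderiv_volumeDensity (hx : x ∈ (chartAt H c).source) (k : ι) :
    mvfderiv I (volumeDensity I b c) x (coordFrame I b c k x) = volumeDensity I b c x *
      ∑ i, coordCoeff I b c i x (leviCivita I M (coordFrame I b c i) x (coordFrame I b c k x)) := by
  have hx' : x ∈ (extChartAt I c).source := by rwa [extChartAt_source]
  have e0 : (extChartAt I c).symm (extChartAt I c x + (0 : ℝ) • b k) = x := by
    simpa using (extChartAt I c).left_inv hx'
  have hpos := (coordGram_posDef (I := I) (b := b) hx).det_pos
  have h1 := hasDerivAt_det (t := 0)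
    (A := fun t : ℝ ↦ coordGram I b c ((extChartAt I c).symm (extChartAt I c x + t • b k)))
    (A' := Matrix.of fun i j ↦ mvfderiv I (fun y ↦ coordGram I b c y i j) x
      (coordFrame I b c k x))
    (fun i j ↦ hasDerivAt_coordLine hx
      ((contMDiffAt_coordGram hx i j).mdifferentiableAt (by simp)) k)
    (by rw [e0]; exact hpos.ne'.isUnit)
  have h2 := h1.sqrt (by rw [e0]; exact hpos.ne')
  have h3 := hasDerivAt_coordLine (b := b) hx
    ((contMDiffAt_volumeDensity (I := I) (b := b) hx).mdifferentiableAt (by simp)) k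
  have h4 := h3.unique h2
  rw [e0] at h4
  rw [h4, mvfderiv_coordGram hx, mul_add, Matrix.trace_add, Matrix.trace_mul_comm,
    Matrix.mul_assoc, Matrix.mul_nonsing_inv _ hpos.ne'.isUnit, mul_one,
    Matrix.nonsing_inv_mul_cancel_left _ _ hpos.ne'.isUnit, Matrix.trace_transpose]
  have h5 := Real.mul_self_sqrt hpos.le
  have h6 : 0 < √(coordGram I b c x).det := Real.sqrt_pos.2 hpos
  rw [volumeDensity]
  simp only [Matrix.trace, Matrix.diag, Matrix.of_apply]
  set S := ∑ i, coordCoeff I b c i x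
    (leviCivita I M (coordFrame I b c i) x (coordFrame I b c k x))
  rw [div_eq_iff (by positivity)]
  linear_combination (-2 * S) * h5

/-- The coordinate expression of the divergence. -/
lemma divergence_eq_coord (hx : x ∈ (chartAt H c).source) {X : Π x : M, TangentSpace I x}
    (hX : MDiffAt (T% X) x) :
    volumeDensity I b c x * divergence X x =
      ∑ k, fderiv ℝ ((fun y ↦ volumeDensity I b c y * coordCoeff I b c k y (X y)) ∘
        (extChartAt I c).symm) (extChartAt I c x) (b k) := by
  have hd : MDiffAt (volumeDensity I b c) x :=
    (contMDiffAt_volumeDensity hx).mdifferentiableAt (by simp)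
  have hc (k) := mdifferentiableAt_coordCoeff (b := b) hx hX k
  have h1 (k) := mvfderiv_coordFrame (b := b) hx (hd.mul (hc k)) k
  have h2 (k) : mvfderiv I (fun y ↦ volumeDensity I b c y * coordCoeff I b c k y (X y)) x
      (coordFrame I b c k x) = volumeDensity I b c x * mvfderiv I
        (fun y ↦ coordCoeff I b c k y (X y)) x (coordFrame I b c k x) + coordCoeff I b c k x (X x) *
          (volumeDensity I b c x * ∑ i, coordCoeff I b c i x
            (leviCivita I M (coordFrame I b c i) x (coordFrame I b c k x))) := by
    rw [mvfderiv_fun_mul hd (hc k), ← mvfderiv_volumeDensity hx]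
    simp
  have h3 : ∑ k, fderiv ℝ ((fun y ↦ volumeDensity I b c y * coordCoeff I b c k y (X y)) ∘
        (extChartAt I c).symm) (extChartAt I c x) (b k) =
      ∑ k, mvfderiv I (fun y ↦ volumeDensity I b c y * coordCoeff I b c k y (X y)) x
        (coordFrame I b c k x) := Finset.sum_congr rfl fun k _ ↦ (h1 k).symm
  rw [h3, divergence, trace_eq_sum_coordCoeff (b := b) hx]
  simp only [h2, ContinuousLinearMap.coe_coe, coordCoeff_leviCivita hx hX, Finset.mul_sum,
    Finset.sum_add_distrib, mul_add]
  congr 1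
  rw [Finset.sum_comm]
  refine Finset.sum_congr rfl fun k _ ↦ Finset.sum_congr rfl fun i _ ↦ ?_
  rw [leviCivita_coordFrame_comm hx k i]
  ring

end VolumeDensity

section RiemannianVolume

variable {n : ℕ} {M : Type*} [TopologicalSpace M] [ChartedSpace (EuclideanSpace ℝ (Fin n)) M]
  [IsManifold (𝓡 n) ∞ M] [RiemannianBundle (fun x : M ↦ TangentSpace (𝓡 n) x)]
  [IsContMDiffRiemannianBundle (𝓡 n) ∞ (EuclideanSpace ℝ (Fin n))
    (fun x : M ↦ TangentSpace (𝓡 n) x)]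
  {c c' : M} {p : EuclideanSpace ℝ (Fin n)}

lemma extChartAt_symm_mem_source (hp : p ∈ (extChartAt (𝓡 n) c).target) :
    (extChartAt (𝓡 n) c).symm p ∈ (chartAt (EuclideanSpace ℝ (Fin n)) c).source := by
  rw [← extChartAt_source (𝓡 n)]
  exact (extChartAt (𝓡 n) c).map_target hp

lemma gramMatrix_eq (hp : p ∈ (extChartAt (𝓡 n) c).target) :
    gramMatrix c p = coordGram (𝓡 n) (EuclideanSpace.basisFun (Fin n) ℝ).toBasis c
      ((extChartAt (𝓡 n) c).symm p) := by
  ext i j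
  have h := extChartAt_symm_mem_source hp
  simp only [gramMatrix, coordGram, Matrix.gram_apply, Matrix.of_apply]
  rw [coordFrame_eq_mfderiv_symm h, coordFrame_eq_mfderiv_symm h,
    (extChartAt (𝓡 n) c).right_inv hp]
  simp

lemma sqrt_det_gramMatrix (hp : p ∈ (extChartAt (𝓡 n) c).target) :
    √(gramMatrix c p).det = volumeDensity (𝓡 n) (EuclideanSpace.basisFun (Fin n) ℝ).toBasis c
      ((extChartAt (𝓡 n) c).symm p) := by
  rw [gramMatrix_eq hp, volumeDensity]

lemma differentiableAt_transition (hp : p ∈ (extChartAt (𝓡 n) c).target)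
    (hp' : (extChartAt (𝓡 n) c).symm p ∈ (chartAt (EuclideanSpace ℝ (Fin n)) c').source) :
    DifferentiableAt ℝ (extChartAt (𝓡 n) c' ∘ (extChartAt (𝓡 n) c).symm) p := by
  have h1 := ((contMDiffOn_extChartAt_symm (I := 𝓡 n) (n := ∞) c) p hp).contMDiffAt
    ((isOpen_extChartAt_target c).mem_nhds hp)
  have h2 := (contMDiffAt_extChartAt' (I := 𝓡 n) (n := ∞) hp').comp p h1
  exact h2.contDiffAt.differentiableAt (by simp)

lemma volumeDensity_transition (hp : p ∈ (extChartAt (𝓡 n) c).target)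
    (hp' : (extChartAt (𝓡 n) c).symm p ∈ (chartAt (EuclideanSpace ℝ (Fin n)) c').source) :
    √(gramMatrix c p).det =
      |(fderiv ℝ (extChartAt (𝓡 n) c' ∘ (extChartAt (𝓡 n) c).symm) p).det| *
      √(gramMatrix c' (extChartAt (𝓡 n) c' ((extChartAt (𝓡 n) c).symm p))).det := by
  set b := (EuclideanSpace.basisFun (Fin n) ℝ).toBasis
  set κ := extChartAt (𝓡 n) c' ∘ (extChartAt (𝓡 n) c).symm with hκ
  set x := (extChartAt (𝓡 n) c).symm p with hx
  have hxc := extChartAt_symm_mem_source hp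
  rw [← hx] at hxc
  have hx' : x ∈ (extChartAt (𝓡 n) c').source := by rwa [extChartAt_source]
  have h1 (i) : mfderiv (𝓡 n) (𝓡 n) (extChartAt (𝓡 n) c') x (coordFrame (𝓡 n) b c i x) =
      fderiv ℝ κ p (b i) := by
    have hs := mdifferentiableWithinAt_extChartAt_symm hp
    rw [ModelWithCorners.range_eq_univ, mdifferentiableWithinAt_univ] at hs
    have h2 := mfderiv_comp_apply p (mdifferentiableAt_extChartAt (I := 𝓡 n) hp') hs (b i)
    rw [mfderiv_eq_fderiv] at h2
    rw [coordFrame_eq_mfderiv_symm hxc, (extChartAt (𝓡 n) c).right_inv hp]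
    exact h2.symm
  have h2 (i k) : coordCoeff (𝓡 n) b c' k x (coordFrame (𝓡 n) b c i x) =
      LinearMap.toMatrix b b (fderiv ℝ κ p).toLinearMap k i := by
    rw [LinearMap.toMatrix_apply]
    change _ = b.repr (fderiv ℝ κ p (b i)) k
    rw [← h1 i]
    conv_rhs => rw [← sum_coordCoeff (b := b) hp' (coordFrame (𝓡 n) b c i x)]
    have h3 : mfderiv (𝓡 n) (𝓡 n) (extChartAt (𝓡 n) c') x
        (∑ l, coordCoeff (𝓡 n) b c' l x (coordFrame (𝓡 n) b c i x) • coordFrame (𝓡 n) b c' l x) =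
        ∑ l, coordCoeff (𝓡 n) b c' l x (coordFrame (𝓡 n) b c i x) • b l := by
      rw [map_sum]
      refine Finset.sum_congr rfl fun l _ ↦ ?_
      rw [map_smul, mfderiv_extChartAt_coordFrame hp']
      rfl
    rw [h3, b.repr_sum_self]
  have h4 : coordGram (𝓡 n) b c x =
      (LinearMap.toMatrix b b (fderiv ℝ κ p).toLinearMap).transpose * coordGram (𝓡 n) b c' x *
        LinearMap.toMatrix b b (fderiv ℝ κ p).toLinearMap := by
    ext i j
    rw [Matrix.mul_assoc, Matrix.mul_apply]
    simp only [Matrix.mul_apply, Matrix.transpose_apply, ← h2]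
    simp only [coordGram, Matrix.gram_apply]
    conv_lhs => rw [← sum_coordCoeff (b := b) hp' (coordFrame (𝓡 n) b c i x),
      ← sum_coordCoeff (b := b) hp' (coordFrame (𝓡 n) b c j x)]
    simp only [sum_inner, inner_sum, inner_smul_left, inner_smul_right, conj_trivial,
      Finset.mul_sum]
    rw [Finset.sum_comm]
    exact Finset.sum_congr rfl fun _ _ ↦ Finset.sum_congr rfl fun _ _ ↦ by ring
  have hq : extChartAt (𝓡 n) c' x ∈ (extChartAt (𝓡 n) c').target :=
    (extChartAt (𝓡 n) c').map_source hx'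
  rw [gramMatrix_eq hp, gramMatrix_eq hq, (extChartAt (𝓡 n) c').left_inv hx', ← hx, h4,
    Matrix.det_mul, Matrix.det_mul, Matrix.det_transpose, LinearMap.det_toMatrix,
    mul_right_comm, Real.sqrt_mul (mul_self_nonneg _), Real.sqrt_mul_self_eq_abs]

variable [MeasurableSpace M] [BorelSpace M]

lemma measurableSet_target : MeasurableSet (extChartAt (𝓡 n) c).target :=
  (isOpen_extChartAt_target c).measurableSet

lemma aemeasurable_extChartAt_symm :
    AEMeasurable (extChartAt (𝓡 n) c).symm ((volume.restrict (extChartAt (𝓡 n) c).target).withDensity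
      fun p ↦ ENNReal.ofReal (√(gramMatrix c p).det)) :=
  ((continuousOn_extChartAt_symm c).aemeasurable measurableSet_target).mono_ac
    (withDensity_absolutelyContinuous _ _)

lemma chartVolume_apply {s : Set M} (hs : MeasurableSet s) :
    chartVolume (n := n) c s =
      ∫⁻ p in (extChartAt (𝓡 n) c).symm ⁻¹' s ∩ (extChartAt (𝓡 n) c).target,
        ENNReal.ofReal (√(gramMatrix c p).det) := by
  rw [chartVolume, Measure.map_apply_of_aemeasurable aemeasurable_extChartAt_symm hs,
    withDensity_apply', Measure.restrict_restrict' measurableSet_target]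

lemma measurableSet_preimage_extChartAt_symm {s : Set M} (hs : MeasurableSet s) :
    MeasurableSet ((extChartAt (𝓡 n) c).symm ⁻¹' s ∩ (extChartAt (𝓡 n) c).target) := by
  have h := (continuousOn_iff_continuous_domRestrict.1
    (continuousOn_extChartAt_symm (I := 𝓡 n) c)).measurable hs
  have h2 := measurableSet_target (n := n) (c := c) |>.subtype_image h
  convert h2 using 1
  ext q
  simp [and_comm]

lemma chartVolume_restrict_le (c c' : M) :
    (chartVolume (n := n) c).restrict (chartAt (EuclideanSpace ℝ (Fin n)) c').source ≤
      chartVolume (n := n) c' := by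
  refine Measure.le_iff.2 fun s hs ↦ ?_
  have hU := (chartAt (EuclideanSpace ℝ (Fin n)) c').open_source.measurableSet
  rw [Measure.restrict_apply hs, chartVolume_apply (hs.inter hU), chartVolume_apply hs]
  set A := (extChartAt (𝓡 n) c).symm ⁻¹' (s ∩ (chartAt (EuclideanSpace ℝ (Fin n)) c').source) ∩
    (extChartAt (𝓡 n) c).target with hA
  set κ := extChartAt (𝓡 n) c' ∘ (extChartAt (𝓡 n) c).symm with hκ
  have hAm : MeasurableSet A := measurableSet_preimage_extChartAt_symm (hs.inter hU)
  have h1 : ∀ p ∈ A, (extChartAt (𝓡 n) c).symm p ∈ (extChartAt (𝓡 n) c').source := fun p hp ↦ by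
    rw [extChartAt_source]
    exact hp.1.2
  calc _ = ∫⁻ p in A, ENNReal.ofReal |(fderiv ℝ κ p).det| *
        ENNReal.ofReal (√(gramMatrix c' (κ p)).det) := by
        refine setLIntegral_congr_fun hAm fun p hp ↦ ?_
        rw [volumeDensity_transition hp.2 hp.1.2, ENNReal.ofReal_mul (abs_nonneg _)]
        rfl
    _ = ∫⁻ q in κ '' A, ENNReal.ofReal (√(gramMatrix c' q).det) := by
        refine (lintegral_image_eq_lintegral_abs_det_fderiv_mul volume hAm
          (fun p hp ↦ (differentiableAt_transition hp.2 hp.1.2).hasFDerivAt.hasFDerivWithinAt) ?_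
          (fun q ↦ ENNReal.ofReal (√(gramMatrix c' q).det))).symm
        intro p hp q hq hpq
        exact (extChartAt (𝓡 n) c).symm.injOn hp.2 hq.2
          ((extChartAt (𝓡 n) c').injOn (h1 p hp) (h1 q hq) hpq)
    _ ≤ _ := by
        refine lintegral_mono_set ?_
        rintro _ ⟨p, hp, rfl⟩
        refine ⟨?_, (extChartAt (𝓡 n) c').map_source (h1 p hp)⟩
        rw [mem_preimage, hκ, Function.comp_apply, (extChartAt (𝓡 n) c').left_inv (h1 p hp)]
        exact hp.1.1

lemma chartVolume_restrict_source (c : M) :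
    (chartVolume (n := n) c).restrict (chartAt (EuclideanSpace ℝ (Fin n)) c).source =
      chartVolume (n := n) c := by
  have hU := (chartAt (EuclideanSpace ℝ (Fin n)) c).open_source.measurableSet
  refine Measure.restrict_eq_self_of_ae_mem ?_
  rw [ae_iff]
  change chartVolume c (chartAt (EuclideanSpace ℝ (Fin n)) c).sourceᶜ = 0
  rw [chartVolume_apply hU.compl]
  convert setLIntegral_empty _
  rw [eq_empty_iff_forall_notMem]
  exact fun p hp ↦ hp.1 (extChartAt_symm_mem_source hp.2)

/-- The Riemannian volume is `√(det g_ij) dp` in every chart. -/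
lemma riemannianVolume_restrict_source (c : M) :
    (riemannianVolume n M).restrict (chartAt (EuclideanSpace ℝ (Fin n)) c).source =
      chartVolume (n := n) c := by
  set U := (chartAt (EuclideanSpace ℝ (Fin n)) c).source
  have hU : MeasurableSet U := (chartAt (EuclideanSpace ℝ (Fin n)) c).open_source.measurableSet
  refine le_antisymm ?_ ?_
  · have h : riemannianVolume n M ≤ chartVolume (n := n) c + (⊤ : Measure M).restrict Uᶜ := by
      refine iSup_le fun d ↦ ?_
      rw [← Measure.restrict_add_restrict_compl (μ := chartVolume (n := n) d) hU]
      exact add_le_add (chartVolume_restrict_le d c) (Measure.restrict_mono le_rfl le_top)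
    refine (Measure.restrict_mono le_rfl h).trans ?_
    rw [Measure.restrict_add, Measure.restrict_restrict hU, inter_compl_self,
      Measure.restrict_empty, add_zero]
    exact Measure.restrict_le_self
  · rw [← chartVolume_restrict_source c]
    exact Measure.restrict_mono le_rfl (le_iSup (fun d ↦ chartVolume (n := n) d) c)

lemma continuousOn_sqrt_det_gramMatrix :
    ContinuousOn (fun p ↦ √(gramMatrix c p).det) (extChartAt (𝓡 n) c).target := by
  intro p hp
  refine ContinuousWithinAt.congr ?_ (fun q hq ↦ sqrt_det_gramMatrix hq) (sqrt_det_gramMatrix hp)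
  exact (contDiffAt_comp_extChartAt_symm hp (contMDiffAt_volumeDensity
    (extChartAt_symm_mem_source hp))).continuousAt.continuousWithinAt

lemma integral_riemannianVolume {F : M → ℝ}
    (hF : ContinuousOn F (chartAt (EuclideanSpace ℝ (Fin n)) c).source)
    (hF0 : ∀ x ∉ (chartAt (EuclideanSpace ℝ (Fin n)) c).source, F x = 0) :
    (IntegrableOn (fun p ↦ √(gramMatrix c p).det * F ((extChartAt (𝓡 n) c).symm p))
      (extChartAt (𝓡 n) c).target → Integrable F (riemannianVolume n M)) ∧
    ∫ x, F x ∂(riemannianVolume n M) = ∫ p in (extChartAt (𝓡 n) c).target,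
      √(gramMatrix c p).det * F ((extChartAt (𝓡 n) c).symm p) := by
  set U := (chartAt (EuclideanSpace ℝ (Fin n)) c).source
  have hU : MeasurableSet U := (chartAt (EuclideanSpace ℝ (Fin n)) c).open_source.measurableSet
  have hFm : AEStronglyMeasurable F (chartVolume (n := n) c) := by
    rw [← riemannianVolume_restrict_source]
    exact hF.aestronglyMeasurable hU
  have hdm : AEMeasurable (fun p ↦ (√(gramMatrix c p).det).toNNReal)
      (volume.restrict (extChartAt (𝓡 n) c).target) :=
    (continuousOn_sqrt_det_gramMatrix.aemeasurable measurableSet_target).real_toNNReal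
  constructor
  · intro h
    rw [← integrableOn_iff_integrable_of_support_subset (s := U)
      (fun x hx ↦ by_contra fun h ↦ hx (hF0 x h)), IntegrableOn, riemannianVolume_restrict_source,
      chartVolume, integrable_map_measure hFm aemeasurable_extChartAt_symm]
    refine (integrable_withDensity_iff_integrable_coe_smul₀ hdm).2 ?_
    refine h.congr (ae_of_all _ fun p ↦ ?_)
    simp [Real.sqrt_nonneg]
  · rw [← setIntegral_eq_integral_of_forall_compl_eq_zero (s := U) hF0,
      riemannianVolume_restrict_source, chartVolume,
      integral_map aemeasurable_extChartAt_symm hFm]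
    refine (integral_withDensity_eq_integral_smul₀ hdm _).trans ?_
    refine integral_congr_ae (ae_of_all _ fun p ↦ ?_)
    simp [NNReal.smul_def, Real.sqrt_nonneg]

end RiemannianVolume

section Extension

/-- A function that is smooth on an open set and vanishes there outside a compact subset extends
by zero to a smooth function of compact support. -/
lemma contDiff_indicator {E : Type*} [NormedAddCommGroup E] [NormedSpace ℝ E] {f : E → ℝ}
    {k : ℕ∞ω} {T K : Set E} (hT : IsOpen T) (hf : ContDiffOn ℝ k f T) (hK : IsCompact K)
    (hKT : K ⊆ T) (hf0 : ∀ p ∈ T, p ∉ K → f p = 0) :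
    ContDiff ℝ k (T.indicator f) ∧ HasCompactSupport (T.indicator f) ∧
      tsupport (T.indicator f) ⊆ K := by
  have h0 : ∀ p ∉ K, T.indicator f p = 0 := fun p hp ↦ by
    by_cases h : p ∈ T
    · rw [indicator_of_mem h, hf0 p h hp]
    · exact indicator_of_notMem h f
  refine ⟨contDiff_iff_contDiffAt.2 fun p ↦ ?_, HasCompactSupport.intro hK h0,
    closure_minimal (fun p hp ↦ by_contra fun h ↦ hp (h0 p h)) hK.isClosed⟩
  by_cases hp : p ∈ T
  · refine (hf.contDiffAt (hT.mem_nhds hp)).congr_of_eventuallyEq ?_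
    filter_upwards [hT.mem_nhds hp] with q hq using indicator_of_mem hq f
  · refine (contDiffAt_const (c := (0 : ℝ))).congr_of_eventuallyEq ?_
    filter_upwards [hK.isClosed.isOpen_compl.mem_nhds fun h ↦ hp (hKT h)] with q hq using h0 q hq

lemma integral_fderiv_eq_zero {E : Type*} [NormedAddCommGroup E] [NormedSpace ℝ E]
    [FiniteDimensional ℝ E] [MeasurableSpace E] [BorelSpace E] (μ : Measure E) [μ.IsAddHaarMeasure]
    {f : E → ℝ} (hf : ContDiff ℝ 1 f) (hc : HasCompactSupport f) (v : E) :
    ∫ p, fderiv ℝ f p v ∂μ = 0 := by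
  have hi : Integrable (fun p ↦ fderiv ℝ f p v) μ :=
    ((hf.continuous_fderiv one_ne_zero).clm_apply continuous_const).integrable_of_hasCompactSupport
      (hc.fderiv_apply ℝ v)
  have h := integral_mul_fderiv_eq_neg_fderiv_mul_of_integrable (μ := μ) (f := fun _ ↦ (1 : ℝ))
    (g := f) (v := v) (by simp) (by simpa using hi)
    (by simpa using hf.continuous.integrable_of_hasCompactSupport hc)
    (fun _ _ ↦ differentiableAt_const _) (fun _ _ ↦ hf.differentiable one_ne_zero _)
  simpa using h

end Extension

section VectorFields

variable {E : Type*} [NormedAddCommGroup E] [NormedSpace ℝ E]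
  {H : Type*} [TopologicalSpace H] {I : ModelWithCorners ℝ E H}
  {M : Type*} [TopologicalSpace M] [ChartedSpace H M] [IsManifold I ∞ M]

/-- `X` is a smooth vector field. -/
abbrev IsSmoothVectorField (X : Π x : M, TangentSpace I x) : Prop := CMDiff ∞ (T% X)

lemma IsSmoothVectorField.mdifferentiableAt {X : Π x : M, TangentSpace I x}
    (hX : IsSmoothVectorField X) (x : M) : MDiffAt (T% X) x :=
  (hX x).mdifferentiableAt (by simp)

lemma IsSmoothVectorField.smul {X : Π x : M, TangentSpace I x} (hX : IsSmoothVectorField X)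
    {f : M → ℝ} (hf : CMDiff ∞ f) : IsSmoothVectorField (f • X) :=
  hf.smul_section hX

end VectorFields

section Divergence

variable {n : ℕ} {M : Type*} [TopologicalSpace M] [ChartedSpace (EuclideanSpace ℝ (Fin n)) M]
  [IsManifold (𝓡 n) ∞ M] [RiemannianBundle (fun x : M ↦ TangentSpace (𝓡 n) x)]
  [IsContMDiffRiemannianBundle (𝓡 n) ∞ (EuclideanSpace ℝ (Fin n))
    (fun x : M ↦ TangentSpace (𝓡 n) x)]
  {c : M} {K : Set M} {X : Π x : M, TangentSpace (𝓡 n) x}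

lemma isCompact_image_extChartAt (hK : IsCompact K)
    (hKU : K ⊆ (chartAt (EuclideanSpace ℝ (Fin n)) c).source) :
    IsCompact (extChartAt (𝓡 n) c '' K) ∧ extChartAt (𝓡 n) c '' K ⊆ (extChartAt (𝓡 n) c).target ∧
      ∀ p ∈ (extChartAt (𝓡 n) c).target, p ∉ extChartAt (𝓡 n) c '' K →
        (extChartAt (𝓡 n) c).symm p ∉ K := by
  rw [← extChartAt_source (𝓡 n)] at hKU
  refine ⟨hK.image_of_continuousOn ((continuousOn_extChartAt c).mono hKU), ?_, ?_⟩
  · rintro _ ⟨x, hx, rfl⟩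
    exact (extChartAt (𝓡 n) c).map_source (hKU hx)
  · exact fun p hp h h' ↦ h ⟨_, h', (extChartAt (𝓡 n) c).right_inv hp⟩

lemma divergence_eq_zero (hX : IsSmoothVectorField X) (hK : IsClosed K) (hXK : ∀ x ∉ K, X x = 0) {x : M}
    (hx : x ∉ K) : divergence X x = 0 := by
  have h : leviCivita (𝓡 n) M X x = leviCivita (𝓡 n) M 0 x := by
    refine leviCivita_congr (hX.mdifferentiableAt x)
      (mdifferentiableAt_zeroSection ..) ?_
    filter_upwards [hK.isOpen_compl.mem_nhds hx] with y hy using hXK y hy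
  have h0 : leviCivita (𝓡 n) M 0 x = 0 := (leviCivita (𝓡 n) M).isCovariantDerivativeOnUniv.zero
  rw [divergence, h, h0]
  simp

variable [MeasurableSpace M] [BorelSpace M]

/-- The integral over the manifold of a continuous function with compact support in the domain of a
chart, as the integral of a continuous function with compact support in the model space. -/
lemma integral_riemannianVolume_of_isCompact {F : M → ℝ}
    (hF : ContinuousOn F (chartAt (EuclideanSpace ℝ (Fin n)) c).source) (hK : IsCompact K)
    (hKU : K ⊆ (chartAt (EuclideanSpace ℝ (Fin n)) c).source) (hF0 : ∀ x ∉ K, F x = 0) :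
    ∃ h : EuclideanSpace ℝ (Fin n) → ℝ, h = (extChartAt (𝓡 n) c).target.indicator
      (fun p ↦ √(gramMatrix c p).det * F ((extChartAt (𝓡 n) c).symm p)) ∧ Continuous h ∧
      HasCompactSupport h ∧ Integrable F (riemannianVolume n M) ∧
      ∫ x, F x ∂(riemannianVolume n M) = ∫ p, h p := by
  obtain ⟨h1, h2, h3⟩ := isCompact_image_extChartAt hK hKU
  have hc : ContinuousOn (fun p ↦ √(gramMatrix c p).det * F ((extChartAt (𝓡 n) c).symm p))
      (extChartAt (𝓡 n) c).target :=
    continuousOn_sqrt_det_gramMatrix.mul (hF.comp (continuousOn_extChartAt_symm c)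
      fun p hp ↦ extChartAt_symm_mem_source hp)
  obtain ⟨h4, h5, -⟩ := contDiff_indicator (k := 0) (isOpen_extChartAt_target c)
    (contDiffOn_zero.2 hc) h1 h2 (fun p hp hpK ↦ by rw [hF0 _ (h3 p hp hpK), mul_zero])
  obtain ⟨h6, h7⟩ := integral_riemannianVolume hF (fun x hx ↦ hF0 x fun h ↦ hx (hKU h))
  refine ⟨_, rfl, h4.continuous, h5, h6 ?_, ?_⟩
  · rw [← integrable_indicator_iff measurableSet_target]
    exact h4.continuous.integrable_of_hasCompactSupport h5
  · rw [h7, integral_indicator measurableSet_target]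

lemma integral_divergence_of_subset_source (hX : IsSmoothVectorField X) (hK : IsCompact K)
    (hKc : IsClosed K) (hKU : K ⊆ (chartAt (EuclideanSpace ℝ (Fin n)) c).source)
    (hXK : ∀ x ∉ K, X x = 0) :
    Integrable (divergence X) (riemannianVolume n M) ∧
      ∫ x, divergence X x ∂(riemannianVolume n M) = 0 := by
  set b := (EuclideanSpace.basisFun (Fin n) ℝ).toBasis
  set T := (extChartAt (𝓡 n) c).target
  obtain ⟨h1, h2, h3⟩ := isCompact_image_extChartAt hK hKU
  set f : Fin n → EuclideanSpace ℝ (Fin n) → ℝ := fun k ↦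
    (fun y ↦ volumeDensity (𝓡 n) b c y * coordCoeff (𝓡 n) b c k y (X y)) ∘
      (extChartAt (𝓡 n) c).symm
  have hf (k) : ContDiffOn ℝ ∞ (f k) T := fun p hp ↦
    (contDiffAt_comp_extChartAt_symm hp ((contMDiffAt_volumeDensity
      (extChartAt_symm_mem_source hp)).mul ((contMDiffAt_iff_coordCoeff
        (extChartAt_symm_mem_source hp)).1 (hX _) k))).contDiffWithinAt
  have hg (k) := contDiff_indicator (isOpen_extChartAt_target c) (hf k) h1 h2
    fun p hp hpK ↦ by
      simp only [f, Function.comp_apply]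
      rw [hXK _ (h3 p hp hpK), map_zero, mul_zero]
  have hfg (k) {p} (hp : p ∈ T) : fderiv ℝ (f k) p = fderiv ℝ (T.indicator (f k)) p := by
    refine Filter.EventuallyEq.fderiv_eq ?_
    filter_upwards [(isOpen_extChartAt_target (I := 𝓡 n) c).mem_nhds hp] with q hq
      using (indicator_of_mem hq _).symm
  have hdiv : ∀ p ∈ T, √(gramMatrix c p).det * divergence X ((extChartAt (𝓡 n) c).symm p) =
      ∑ k, fderiv ℝ (T.indicator (f k)) p (b k) := fun p hp ↦ by
    rw [sqrt_det_gramMatrix hp, divergence_eq_coord (b := b) (extChartAt_symm_mem_source hp)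
      (hX.mdifferentiableAt _), (extChartAt (𝓡 n) c).right_inv hp]
    exact Finset.sum_congr rfl fun k _ ↦ by rw [← hfg k hp]
  have hgc (k) : Continuous fun p ↦ fderiv ℝ (T.indicator (f k)) p (b k) :=
    ((hg k).1.continuous_fderiv (by simp)).clm_apply continuous_const
  have hcont : ContinuousOn (divergence X) (chartAt (EuclideanSpace ℝ (Fin n)) c).source := by
    have hd : ContinuousOn (volumeDensity (𝓡 n) b c)
        (chartAt (EuclideanSpace ℝ (Fin n)) c).source := fun x hx ↦
      (contMDiffAt_volumeDensity hx).continuousAt.continuousWithinAt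
    have hs : ContinuousOn (fun x ↦ ∑ k, fderiv ℝ (T.indicator (f k)) (extChartAt (𝓡 n) c x) (b k))
        (chartAt (EuclideanSpace ℝ (Fin n)) c).source := by
      have := (continuous_finsetSum Finset.univ fun k _ ↦ hgc k).comp_continuousOn
        (continuousOn_extChartAt (I := 𝓡 n) c)
      rwa [extChartAt_source] at this
    refine ((hd.inv₀ fun x hx ↦ (volumeDensity_pos hx).ne').mul hs).congr fun x hx ↦ ?_
    have hx' : x ∈ (extChartAt (𝓡 n) c).source := by rwa [extChartAt_source]
    have hp := (extChartAt (𝓡 n) c).map_source hx'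
    have := hdiv _ hp
    rw [sqrt_det_gramMatrix hp, (extChartAt (𝓡 n) c).left_inv hx'] at this
    change _ = (volumeDensity (𝓡 n) b c x)⁻¹ * ∑ k, _
    rw [← this, inv_mul_cancel_left₀ (volumeDensity_pos hx).ne']
  obtain ⟨h, rfl, -, -, hint, hI⟩ := integral_riemannianVolume_of_isCompact hcont hK hKU
    fun x hx ↦ divergence_eq_zero hX hKc hXK hx
  refine ⟨hint, ?_⟩
  have hsum : T.indicator (fun p ↦ √(gramMatrix c p).det *
      divergence X ((extChartAt (𝓡 n) c).symm p)) =
      fun p ↦ ∑ k, fderiv ℝ (T.indicator (f k)) p (b k) := by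
    ext p
    by_cases hp : p ∈ T
    · rw [indicator_of_mem hp, hdiv p hp]
    · rw [indicator_of_notMem hp]
      refine (Finset.sum_eq_zero fun k _ ↦ ?_).symm
      rw [fderiv_of_notMem_tsupport ℝ fun h ↦ hp (h2 ((hg k).2.2 h))]
      rfl
  rw [hI, hsum, integral_finsetSum _ fun k _ ↦
    (hgc k).integrable_of_hasCompactSupport ((hg k).2.1.fderiv_apply ℝ (b k))]
  exact Finset.sum_eq_zero fun k _ ↦
    integral_fderiv_eq_zero volume ((hg k).1.of_le (by simp)) (hg k).2.1 (b k)

/-- The divergence theorem for compactly supported vector fields. -/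
theorem integral_divergence [T2Space M] [SigmaCompactSpace M] (hX : IsSmoothVectorField X)
    (hK : IsCompact K) (hXK : ∀ x ∉ K, X x = 0) :
    Integrable (divergence X) (riemannianVolume n M) ∧
      ∫ x, divergence X x ∂(riemannianVolume n M) = 0 := by
  obtain ⟨ρ, hρ⟩ := SmoothPartitionOfUnity.exists_isSubordinate_chartAt_source (𝓡 n) M
  have hfin := ρ.locallyFinite.finite_nonempty_inter_compact hK
  set S := hfin.toFinset
  have hsum (x : M) (hx : x ∈ K) : ∑ i ∈ S, ρ i x = 1 := by
    rw [← ρ.sum_eq_one (mem_univ x)]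
    refine (finsum_eq_sum_of_support_subset _ fun i hi ↦ ?_).symm
    exact hfin.mem_toFinset.2 ⟨x, hi, hx⟩
  have hρd (i) (x : M) : MDifferentiableAt (𝓡 n) 𝓘(ℝ) (ρ i) x :=
    ((ρ i).contMDiff x).mdifferentiableAt (by simp)
  have hXd := hX.mdifferentiableAt
  have hρX (i) : IsSmoothVectorField ((ρ i : M → ℝ) • X) := hX.smul (ρ i).contMDiff
  have hdec (x : M) : divergence X x = ∑ i ∈ S, divergence ((ρ i : M → ℝ) • X) x := by
    have h1 : X = fun y ↦ ∑ i ∈ S, ρ i y • X y := by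
      ext1 y
      rw [← Finset.sum_smul]
      by_cases hy : y ∈ K
      · rw [hsum y hy, one_smul]
      · rw [hXK y hy, smul_zero]
    obtain ⟨h2, h3⟩ := leviCivita_sum (x := x) S (f := fun i ↦ ρ i) (X := fun _ ↦ X)
      (fun i _ ↦ hρd i x) (fun _ _ ↦ hXd x)
    have h4 : leviCivita (𝓡 n) M X x = ∑ i ∈ S, leviCivita (𝓡 n) M ((ρ i : M → ℝ) • X) x := by
      ext1 v
      conv_lhs => rw [h1]
      rw [h3, sum_apply]
      refine Finset.sum_congr rfl fun i _ ↦ ?_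
      have h5 : leviCivita (𝓡 n) M ((ρ i : M → ℝ) • X) x = ρ i x • leviCivita (𝓡 n) M X x +
          (mvfderiv (𝓡 n) (ρ i) x).smulRight (X x) :=
        (leviCivita (𝓡 n) M).isCovariantDerivativeOnUniv.leibniz (hXd x) (hρd i x)
      rw [h5]
      rfl
    simp only [divergence]
    rw [h4, ← map_sum]
    congr 1
    ext v
    simp
  have hloc (i) := integral_divergence_of_subset_source (c := i) (hρX i)
    (hK.inter_right (isClosed_tsupport (ρ i))) (hK.isClosed.inter (isClosed_tsupport (ρ i)))
    (inter_subset_right.trans (hρ i)) (fun x hx ↦ by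
      by_cases hxK : x ∈ K
      · have : ρ i x = 0 := image_eq_zero_of_notMem_tsupport fun h ↦ hx ⟨hxK, h⟩
        simp [this]
      · simp [hXK x hxK])
  have he : divergence X = fun x ↦ ∑ i ∈ S, divergence ((ρ i : M → ℝ) • X) x := funext hdec
  rw [he]
  refine ⟨integrable_finsetSum _ fun i _ ↦ (hloc i).1, ?_⟩
  rw [integral_finsetSum _ fun i _ ↦ (hloc i).1]
  exact Finset.sum_eq_zero fun i _ ↦ (hloc i).2

end Divergence

section Gradient

variable {E : Type*} [NormedAddCommGroup E] [NormedSpace ℝ E] [FiniteDimensional ℝ E]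
  {H : Type*} [TopologicalSpace H] {I : ModelWithCorners ℝ E H} [I.Boundaryless]
  {M : Type*} [TopologicalSpace M] [ChartedSpace H M] [IsManifold I ∞ M]

lemma contMDiffAt_mvfderiv_coordFrame {f : M → ℝ} (hf : CMDiff ∞ f) {ι : Type*}
    {b : Module.Basis ι ℝ E} {c x : M} (hx : x ∈ (chartAt H c).source) (i : ι) :
    CMDiffAt ∞ (fun y ↦ mvfderiv I f y (coordFrame I b c i y)) x := by
  have hx' : x ∈ (extChartAt I c).source := by rwa [extChartAt_source]
  have hp := (extChartAt I c).map_source hx'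
  have h1 : ContDiffAt ℝ ∞ (fun p ↦ fderiv ℝ (f ∘ (extChartAt I c).symm) p (b i))
      (extChartAt I c x) :=
    ((contDiffAt_comp_extChartAt_symm hp (hf _)).fderiv_right (m := ∞) (by simp)).clm_apply
      contDiffAt_const
  refine (h1.contMDiffAt.comp x (contMDiffAt_extChartAt' hx)).congr_of_eventuallyEq ?_
  filter_upwards [(chartAt H c).open_source.mem_nhds hx] with y hy
  exact mvfderiv_coordFrame hy ((hf y).mdifferentiableAt (by simp)) i

lemma exists_eq_const_of_mvfderiv_eq_zero [ConnectedSpace M] {f : M → ℝ} (hf : CMDiff ∞ f)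
    (h : ∀ x, mvfderiv I f x = 0) : ∃ r, ∀ x, f x = r := by
  have hl : IsLocallyConstant f := by
    rw [IsLocallyConstant.iff_eventually_eq]
    intro x
    have hx := mem_chart_source H x
    have hT := extChartAt_target_mem_nhds (I := I) x
    obtain ⟨r, hr, hball⟩ := Metric.mem_nhds_iff.1 hT
    have hsrc {p} (hp : p ∈ Metric.ball (extChartAt I x x) r) :
        (extChartAt I x).symm p ∈ (chartAt H x).source := by
      rw [← extChartAt_source I]
      exact (extChartAt I x).map_target (hball hp)
    have hd : DifferentiableOn ℝ (f ∘ (extChartAt I x).symm)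
        (Metric.ball (extChartAt I x x) r) := fun p hp ↦
      ((contDiffAt_comp_extChartAt_symm (hball hp) (hf _)).differentiableAt
        (by simp)).differentiableWithinAt
    have hz : (Metric.ball (extChartAt I x x) r).EqOn
        (fderiv ℝ (f ∘ (extChartAt I x).symm)) 0 := fun p hp ↦ by
      refine ContinuousLinearMap.coe_injective ((Module.finBasis ℝ E).ext fun i ↦ ?_)
      have := mvfderiv_coordFrame (b := Module.finBasis ℝ E) (hsrc hp)
        ((hf _).mdifferentiableAt (by simp)) i
      rw [(extChartAt I x).right_inv (hball hp), h] at this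
      exact this.symm
    have hcont := (continuousAt_extChartAt (I := I) x).preimage_mem_nhds
      (Metric.ball_mem_nhds _ hr)
    filter_upwards [hcont, (chartAt H x).open_source.mem_nhds hx] with y hy hy'
    have := Metric.isOpen_ball.is_const_of_fderiv_eq_zero
      (convex_ball (extChartAt I x x) r).isPreconnected hd hz hy (Metric.mem_ball_self hr)
    have hy'' : y ∈ (extChartAt I x).source := by rwa [extChartAt_source]
    rwa [Function.comp_apply, Function.comp_apply, (extChartAt I x).left_inv hy'',
      (extChartAt I x).left_inv (mem_extChartAt_source x)] at this
  obtain ⟨x⟩ := ‹ConnectedSpace M›.toNonempty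
  exact ⟨f x, fun y ↦ hl.apply_eq_of_preconnectedSpace y x⟩

variable [RiemannianBundle (fun x : M ↦ TangentSpace I x)]
  [IsContMDiffRiemannianBundle I ∞ E (fun x : M ↦ TangentSpace I x)]

variable (I) in
/-- The gradient of a function. -/
def grad (f : M → ℝ) : Π x : M, TangentSpace I x :=
  OneForm.dual (mvfderiv I f)

lemma inner_grad (f : M → ℝ) (x : M) (v : TangentSpace I x) :
    inner ℝ (grad I f x) v = mvfderiv I f x v :=
  inner_sharp _ _

lemma isSmoothVectorField_grad {f : M → ℝ} (hf : CMDiff ∞ f) :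
    IsSmoothVectorField (grad I f) := fun _ ↦
  contMDiffAt_sharp fun _ i hx ↦ contMDiffAt_mvfderiv_coordFrame hf hx i

lemma OneForm.dual_inner (Z : Π x : M, TangentSpace I x) :
    OneForm.dual (fun x ↦ innerSL ℝ (Z x)) = Z := by
  ext1 x
  exact (eq_sharp_iff.2 fun v ↦ rfl).symm

lemma covectorInner_eq_inner {x : M} (α : TangentSpace I x →L[ℝ] ℝ) (v : TangentSpace I x) :
    covectorInner I x α (innerSL ℝ v) = α v := by
  conv_rhs => rw [← (stdOrthonormalBasis ℝ (TangentSpace I x)).sum_repr' v]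
  simp only [covectorInner, map_sum, map_smul, smul_eq_mul, innerSL_apply_apply]
  exact Finset.sum_congr rfl fun i _ ↦ by rw [mul_comm, real_inner_comm]

lemma BilinForm.contract_eq_zero (φ : BilinForm I M) {Y : Π x : M, TangentSpace I x} {x : M}
    (hx : Y x = 0) : φ.contract Y x = 0 := by
  simp [BilinForm.contract, hx, sharp]

lemma OneForm.dual_eq_zero {θ : OneForm I M} {x : M} (hx : θ x = 0) : θ.dual x = 0 := by
  simp [OneForm.dual, hx, sharp]

lemma BilinForm.IsCodazzi.divergence_contract_dual {φ : BilinForm I M} (hc : φ.IsCodazzi)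
    (hφ : φ.IsSmoothSymm) {θ : OneForm I M} (hθ : θ.IsSmooth) (x : M) :
    divergence (φ.contract θ.dual) x = bilinInner I x (fun u v ↦ φ x u v) (θ.extDeriv x) +
      covectorInner I x (mvfderiv I φ.trace x) (θ x) := by
  rw [RiemannianForms.divergence_contract_dual hφ.smooth hθ]
  congr 2
  ext v
  rw [hφ.mvfderiv_trace]
  exact Finset.sum_congr rfl fun i _ ↦ ((hc x _ _ _).2.trans (hc x _ _ _).1)

end Gradient

section Harmonic

variable {n : ℕ} {M : Type*} [TopologicalSpace M] [ChartedSpace (EuclideanSpace ℝ (Fin n)) M]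
  [IsManifold (𝓡 n) ∞ M] [RiemannianBundle (fun x : M ↦ TangentSpace (𝓡 n) x)]
  [IsContMDiffRiemannianBundle (𝓡 n) ∞ (EuclideanSpace ℝ (Fin n))
    (fun x : M ↦ TangentSpace (𝓡 n) x)]
  [MeasurableSpace M] [BorelSpace M] [T2Space M]

/-- A continuous nonnegative function of compact support in a chart with vanishing integral is
zero. -/
lemma eq_zero_of_integral_riemannianVolume_eq_zero {c : M} {K : Set M} {F : M → ℝ}
    (hF : ContinuousOn F (chartAt (EuclideanSpace ℝ (Fin n)) c).source) (hK : IsCompact K)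
    (hKU : K ⊆ (chartAt (EuclideanSpace ℝ (Fin n)) c).source) (hF0 : ∀ x ∉ K, F x = 0)
    (hnn : ∀ x, 0 ≤ F x) (hI : ∫ x, F x ∂(riemannianVolume n M) = 0) (x : M) : F x = 0 := by
  by_cases hx : x ∈ K
  · obtain ⟨h, rfl, hc, hs, -, hi⟩ := integral_riemannianVolume_of_isCompact hF hK hKU hF0
    have hxs : x ∈ (extChartAt (𝓡 n) c).source := by
      rw [extChartAt_source]
      exact hKU hx
    have hp := (extChartAt (𝓡 n) c).map_source hxs
    by_contra hne
    refine (hc.integral_pos_of_hasCompactSupport_nonneg_nonzero (x := extChartAt (𝓡 n) c x)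
      (μ := volume) hs ?_ ?_).ne' (hi.symm.trans hI)
    · exact fun p ↦ indicator_nonneg (fun q _ ↦ mul_nonneg (Real.sqrt_nonneg _) (hnn _)) p
    · rw [indicator_of_mem hp, sqrt_det_gramMatrix hp, (extChartAt (𝓡 n) c).left_inv hxs]
      exact mul_ne_zero (volumeDensity_pos (hKU hx)).ne' hne
  · exact hF0 x hx

variable {φ : BilinForm (𝓡 n) M}

lemma BilinForm.IsCodazzi.mvfderiv_trace_eq_zero [SigmaCompactSpace M] (hc : φ.IsCodazzi)
    (hφ : φ.IsSmoothSymm) (h : φ.IsCodifferential (fun _ ↦ 0)) (x : M) :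
    mvfderiv (𝓡 n) φ.trace x = 0 := by
  obtain ⟨f⟩ : Nonempty (SmoothBumpFunction (𝓡 n) x) := inferInstance
  have hg : IsSmoothVectorField (grad (𝓡 n) φ.trace) :=
    isSmoothVectorField_grad hφ.smooth.contMDiff_trace
  set Z := (f : M → ℝ) • grad (𝓡 n) φ.trace with hZ
  have hZs : IsSmoothVectorField Z := hg.smul f.contMDiff
  set θ : OneForm (𝓡 n) M := fun x ↦ innerSL ℝ (Z x) with hθ
  have hθs : θ.IsSmooth := isSmooth_inner hZs
  have hd : θ.dual = Z := OneForm.dual_inner Z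
  have hK : IsCompact (tsupport f) := f.hasCompactSupport
  have hf0 (y) (hy : y ∉ tsupport f) : f y = 0 := image_eq_zero_of_notMem_tsupport hy
  have hZ0 (y) (hy : y ∉ tsupport f) : Z y = 0 := by
    rw [hZ, Pi.smul_apply', hf0 y hy, zero_smul]
  have hθ0 : {y | θ y ≠ 0} ⊆ tsupport f := fun y hy ↦ by
    by_contra h
    refine hy ?_
    simp only [hθ, hZ0 y h, map_zero]
  have hcomp : IsCompact (closure {y | θ y ≠ 0}) :=
    hK.of_isClosed_subset isClosed_closure (closure_minimal hθ0 (isClosed_tsupport f))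
  have h1 := h.2 θ hθs hcomp
  obtain ⟨hi, hI⟩ := integral_divergence (hφ.smooth.contMDiff_contract (Y := Z) hZs) hK
    (fun y hy ↦ φ.contract_eq_zero (hZ0 y hy))
  have hdiv (y : M) : divergence (φ.contract Z) y =
      bilinInner (𝓡 n) y (fun u v ↦ φ y u v) (θ.extDeriv y) +
        f y * inner ℝ (grad (𝓡 n) φ.trace y) (grad (𝓡 n) φ.trace y) := by
    rw [← hd, hc.divergence_contract_dual hφ hθs, covectorInner_eq_inner, ← inner_grad, hZ,
      Pi.smul_apply', inner_smul_right]
  have hFc : Continuous fun y ↦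
      (f y * inner ℝ (grad (𝓡 n) φ.trace y) (grad (𝓡 n) φ.trace y) : ℝ) := by
    refine f.continuous.mul (continuous_iff_continuousAt.2 fun y ↦ ?_)
    exact (contMDiffAt_inner (hg y) (hg y)).continuousAt
  have hF0 (y) (hy : y ∉ tsupport f) :
      (f y * inner ℝ (grad (𝓡 n) φ.trace y) (grad (𝓡 n) φ.trace y) : ℝ) = 0 := by
    rw [hf0 y hy, zero_mul]
  have hFi : Integrable (fun y ↦ (f y * inner ℝ (grad (𝓡 n) φ.trace y) (grad (𝓡 n) φ.trace y) : ℝ))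
      (riemannianVolume n M) := by
    obtain ⟨-, -, -, -, hint, -⟩ := integral_riemannianVolume_of_isCompact hFc.continuousOn hK
      f.tsupport_subset_chartAt_source hF0
    exact hint
  have hb : (fun y ↦ bilinInner (𝓡 n) y (fun u v ↦ φ y u v) (θ.extDeriv y)) =
      fun y ↦ divergence (φ.contract Z) y -
        f y * inner ℝ (grad (𝓡 n) φ.trace y) (grad (𝓡 n) φ.trace y) := by
    ext y
    rw [hdiv, add_sub_cancel_right]
  rw [hb, integral_sub hi hFi, hI, zero_sub] at h1
  have h2 : ∫ y, (f y * inner ℝ (grad (𝓡 n) φ.trace y) (grad (𝓡 n) φ.trace y) : ℝ)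
      ∂(riemannianVolume n M) = 0 := by
    rw [← neg_eq_zero, h1]
    simp [covectorInner]
  have h3 := eq_zero_of_integral_riemannianVolume_eq_zero hFc.continuousOn hK
    f.tsupport_subset_chartAt_source hF0 (fun y ↦ mul_nonneg f.nonneg real_inner_self_nonneg) h2 x
  rw [f.eq_one, one_mul, inner_self_eq_zero] at h3
  ext v
  rw [← inner_grad, h3, inner_zero_left]
  rfl

lemma BilinForm.IsCodazzi.isCodifferential_zero [SigmaCompactSpace M] (hc : φ.IsCodazzi)
    (hφ : φ.IsSmoothSymm) (h : ∀ x, mvfderiv (𝓡 n) φ.trace x = 0) :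
    φ.IsCodifferential (fun _ ↦ 0) := by
  refine ⟨contMDiff_zeroSection ℝ (fun x : M ↦ TangentSpace (𝓡 n) x →L[ℝ] ℝ), fun θ hθ hK ↦ ?_⟩
  have hθ0 (y) (hy : y ∉ closure {y | θ y ≠ 0}) : θ y = 0 :=
    by_contra fun h ↦ hy (subset_closure h)
  obtain ⟨-, hI⟩ := integral_divergence (hφ.smooth.contMDiff_contract hθ.contMDiff_dual) hK
    (fun y hy ↦ φ.contract_eq_zero (OneForm.dual_eq_zero (hθ0 y hy)))
  simp only [hc.divergence_contract_dual hφ hθ, h] at hI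
  simpa [covectorInner] using hI

end Harmonic

end RiemannianForms

end
theorem proposition4 {n : ℕ} {M : Type*} [TopologicalSpace M] [T2Space M]
    [SecondCountableTopology M] [ConnectedSpace M]
    [ChartedSpace (EuclideanSpace ℝ (Fin n)) M] [IsManifold (𝓡 n) ∞ M]
    [RiemannianBundle (fun x : M ↦ TangentSpace (𝓡 n) x)]
    [IsContMDiffRiemannianBundle (𝓡 n) ∞ (EuclideanSpace ℝ (Fin n))
      (fun x : M ↦ TangentSpace (𝓡 n) x)]
    [MeasurableSpace M] [BorelSpace M]
    (φ : RiemannianForms.BilinForm (𝓡 n) M) (hφ : φ.IsSmoothSymm) :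
    φ.IsHarmonic ↔ φ.IsCodazzi ∧ ∃ c : ℝ, ∀ x : M, φ.trace x = c := by
  have : LocallyCompactSpace M := ChartedSpace.locallyCompactSpace (EuclideanSpace ℝ (Fin n)) M
  constructor
  · rintro ⟨h1, h2⟩
    have hc : φ.IsCodazzi := fun x u v w ↦
      ⟨sub_eq_zero.1 (h1 x u v w), hφ.covDeriv_symm u v w⟩
    exact ⟨hc, RiemannianForms.exists_eq_const_of_mvfderiv_eq_zero hφ.smooth.contMDiff_trace
      (hc.mvfderiv_trace_eq_zero hφ h2)⟩
  · rintro ⟨hc, r, hr⟩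
    refine ⟨fun x u v w ↦ sub_eq_zero.2 (hc x u v w).1, hc.isCodifferential_zero hφ fun x ↦ ?_⟩
    rw [funext hr]
    exact mvfderiv_const r
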